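/- For a permutation $\pi\in S_n$ put $\pi(0)=0$ and let $\mathrm{lpk}(\pi)$ be the number of left peaks of $\pi$, i.e. of indices $1\le i\le n-1$ with $\pi(i-1)<\pi(i)>\pi(i+1)$. Let $N_i(\pi)$ be the number of $i$-cycles of $\pi$ (fixed points being $1$-cycles). For integers $i\ge 1$ and $m\ge 0$ let $$f_{i,m}=\frac{1}{2i}\sum_{\substack{d\mid i\\ d\ \mathrm{odd}}}\mu(d)\left[(2m+1)^{i/d}-1\right],$$ where $\mu$ is the Möbius function. Then, in the ring $\mathbb{Q}[[t,u,z_1,z_2,\dots]]$ of formal power series, $$\frac{1}{1-t}+\sum_{n\ge 1}u^n\sum_{\pi\in S_n}\frac{(1+t)^n}{(1-t)^{n+1}}\left(\frac{4t}{(1+t)^2}\right)^{\mathrm{lpk}(\pi)}\prod_{i\ge 1}z_i^{N_i(\pi)} =\sum_{m\ge 0}t^m\,\frac{1}{1-z_1u}\prod_{i\ge 1}\left(\frac{1+z_iu^i}{1-z_iu^i}\right)^{f_{i,m}},$$ where all infinite sums and products converge coefficientwise, and powers of series with constant term $1$ are given by the binomial series. -/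

import Mathlib

noncomputable section

namespace LeftPeaks

/-- The formal variables `t`, `u` and `z₁, z₂, z₃, …`. -/
inductive Var : Type
  | t : Var
  | u : Var
  | z : ℕ+ → Var

/-- The ring `ℚ⟦t, u, z₁, z₂, …⟧` of formal power series. -/
abbrev Series : Type := MvPowerSeries Var ℚ

/-- The usual topology on formal power series: `ℚ` is discrete, and convergence means that each
coefficient is eventually constant. Infinite sums and products below refer to this topology. -/
instance instTopologicalSpaceSeries : TopologicalSpace Series :=
  @MvPowerSeries.WithPiTopology.instTopologicalSpace Var ℚ ⊥

/-- The variable `t`. -/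
def t : Series := MvPowerSeries.X Var.t

/-- The variable `u`. -/
def u : Series := MvPowerSeries.X Var.u

/-- The variable `zᵢ`, for `i ≥ 1`. -/
def z (i : ℕ+) : Series := MvPowerSeries.X (Var.z i)

/-- The one-line notation `π(1), …, π(n)` of a permutation, with values in `{1, …, n}`, augmented
by `π(0) = 0` (the values at positions beyond `n` are irrelevant). -/
def oneLine {n : ℕ} (π : Equiv.Perm (Fin n)) : ℕ → ℕ
  | 0 => 0
  | i + 1 => if h : i < n then (π ⟨i, h⟩ : ℕ) + 1 else 0

/-- The number of left peaks of `π`: indices `1 ≤ i < n` with `π(i-1) < π(i) > π(i+1)`, where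
`π(0) = 0`. -/
def lpk {n : ℕ} (π : Equiv.Perm (Fin n)) : ℕ :=
  ((Finset.Ioo 0 n).filter fun i =>
    oneLine π (i - 1) < oneLine π i ∧ oneLine π (i + 1) < oneLine π i).card

/-- `N_i(π)`, the number of `i`-cycles of `π`; fixed points are the `1`-cycles
(`Equiv.Perm.partition` is the full cycle type, in which fixed points are parts equal to `1`). -/
def cycleCount {n : ℕ} (i : ℕ+) (π : Equiv.Perm (Fin n)) : ℕ :=
  π.partition.parts.count (i : ℕ)

/-- `f_{i,m} = (1 / 2i) ∑_{d ∣ i, d odd} μ(d) ((2m+1)^{i/d} - 1)`. -/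
def f (i : ℕ+) (m : ℕ) : ℚ :=
  1 / (2 * (i : ℕ)) *
    ∑ d ∈ (i : ℕ).divisors.filter Odd,
      (ArithmeticFunction.moebius d : ℚ) * ((2 * (m : ℚ) + 1) ^ ((i : ℕ) / d) - 1)

/-- The power `g ^ r` with rational exponent of a formal power series `g` with constant term `1`,
through the binomial series `∑ₖ (r choose k) (g - 1) ^ k`. -/
def ratPow (g : Series) (r : ℚ) : Series :=
  (PowerSeries.binomialSeries ℚ r).subst (g - 1)

/-- The `i`-th factor `((1 + zᵢ uⁱ) / (1 - zᵢ uⁱ)) ^ f_{i,m}`. -/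
def factor (m : ℕ) (i : ℕ+) : Series :=
  ratPow ((1 + z i * u ^ (i : ℕ)) * (1 - z i * u ^ (i : ℕ))⁻¹) (f i m)

/-- The summand for `n` on the left:
`uⁿ ∑_{π ∈ Sₙ} (1+t)ⁿ / (1-t)ⁿ⁺¹ · (4t / (1+t)²) ^ lpk(π) · ∏_{i ≥ 1} zᵢ ^ N_i(π)`
(no cycle of `π` is longer than `n`, so the product stops at `i = n`). -/
def leftTerm (n : ℕ+) : Series :=
  u ^ (n : ℕ) * ∑ π : Equiv.Perm (Fin n),
    ((1 + t) ^ (n : ℕ) * ((1 - t) ^ ((n : ℕ) + 1))⁻¹) *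
      (4 * t * ((1 + t) ^ 2)⁻¹) ^ lpk π *
      ∏ i ∈ Finset.Icc 1 n, z i ^ cycleCount i π

/-- The summand for `m` on the right: `t^m · 1 / (1 - z₁ u) · ∏_{i ≥ 1} factor m i`. -/
def rightTerm (m : ℕ) : Series :=
  t ^ m * (1 - z 1 * u)⁻¹ * ∏' i : ℕ+, factor m i

end LeftPeaks

end

/-! Fix `π` and count its left enriched partitions with letters in `{0, …, 2m}`: weakly increasing
words `w` such that `π` increases on each block of equal even letters and decreases on each block of
equal odd letters (`Good`). A transfer recurrence along the ascent pattern shows that the generating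
function of these counts in `m` is exactly the weight attached to `π` on the left (`good_series`).
Both sides therefore reduce to a statement for each fixed `m` about pairs `(π, w)`, weighted by the
cycle type of `π`.

Such pairs are counted by a signed Gessel–Reutenauer bijection. Give even letters sign `1` and odd
letters sign `-1`, and order periodic words lexicographically, reversing the comparison after a
negative prefix. Reading `w` along the `π`-orbits attaches to each point a periodic word,
monotonically in the point. The pair is determined by the number of points over each word, and any
shift-invariant family of numbers with total `n` occurs (`Good.eq_of_card_fiber`, `exists_good`). So
pairs correspond to multisets of primitive necklaces (`sum_good`).

Suppose a necklace of length `p` has multiplicity `c`. The `p`-th power of `π` maps the `c` points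
over one of its words to themselves, increasingly if the necklace is positive and decreasingly if it
is negative. A positive necklace thus yields `c` cycles of length `p`; a negative one yields `c % 2`
of length `p` and `c / 2` of length `2p`. The generating function is a product of `1 / (1 - z_p
u^p)` over positive necklaces and `(1 + z_p u^p) / (1 - z_{2p} u^{2p})` over negative ones.

Möbius inversion gives `f i m` negative necklaces of length `i` (`necklaceCount_neg`). Positive
necklaces of length `i` together with negative ones of length `i / 2` are as numerous as negative
ones of length `i`, except for one more at `i = 1` (`necklaceCount_pos`). This exception is the
factor `1 / (1 - z₁ u)`; the rest regroups into the powers on the right (`trunc_prod_necklace`). -/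

noncomputable section
namespace LeftPeaks
-- Transfer recurrence for words with a prescribed ascent pattern
/-- `i` may be followed by `j` in a left enriched partition, across an ascent (`b = true`) or a
descent (`b = false`). Even letters label increasing blocks, odd letters decreasing ones. -/
def Step (b : Bool) (i j : ℕ) : Prop := i < j ∨ (i = j ∧ (Even j ↔ b = true))

instance (b : Bool) (i j : ℕ) : Decidable (Step b i j) := by unfold Step; infer_instance

/-- The number of words `w₀ ⋯ w_k` with prescribed ascent pattern `δ` and last letter `j`. -/
def endCount (δ : ℕ → Bool) : ℕ → ℕ → ℕ
  | 0, _ => 1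
  | k + 1, j => ∑ i ∈ Finset.range (j + 1), if Step (δ k) i j then endCount δ k i else 0

/-- The position `k` is reached by an ascent (position `0` always is). -/
def isRise (δ : ℕ → Bool) : ℕ → Bool
  | 0 => true
  | k + 1 => δ k

/-- The number of left peaks among the first `k` positions. -/
def peakCount (δ : ℕ → Bool) (k : ℕ) : ℕ :=
  ((Finset.range k).filter fun j => isRise δ j = true ∧ δ j = false).card

lemma peakCount_succ (δ : ℕ → Bool) (k : ℕ) :
    peakCount δ (k + 1) =
      peakCount δ k + if isRise δ k = true ∧ δ k = false then 1 else 0 := by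
  unfold peakCount
  rw [Finset.range_add_one, Finset.filter_insert]
  split_ifs with h
  · rw [Finset.card_insert_of_notMem (by simp)]
  · rfl

lemma endCount_succ_eq_sum (δ : ℕ → Bool) (k j : ℕ) (h : Even j ↔ δ k = true) :
    endCount δ (k + 1) j = ∑ i ∈ Finset.range (j + 1), endCount δ k i := by
  rw [endCount]
  refine Finset.sum_congr rfl fun i hi => if_pos ?_
  rcases Nat.lt_or_ge i j with hij | hij
  · exact Or.inl hij
  · exact Or.inr ⟨by simp at hi; omega, h⟩

lemma endCount_succ_eq_sum' (δ : ℕ → Bool) (k j : ℕ) (h : ¬ (Even j ↔ δ k = true)) :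
    endCount δ (k + 1) j = ∑ i ∈ Finset.range j, endCount δ k i := by
  rw [endCount, Finset.sum_range_succ, if_neg (by simp [Step, h]), add_zero]
  exact Finset.sum_congr rfl fun i hi => if_pos (Or.inl (by simpa using hi))

/-- Generating function of `endCount` over even last letters. -/
def evenSeries (δ : ℕ → Bool) (k : ℕ) : PowerSeries ℚ :=
  PowerSeries.mk fun r => (endCount δ k (2 * r) : ℚ)

/-- Generating function of `endCount` over odd last letters. -/
def oddSeries (δ : ℕ → Bool) (k : ℕ) : PowerSeries ℚ :=
  PowerSeries.mk fun r => (endCount δ k (2 * r + 1) : ℚ)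

section EnrichedPartitions

open PowerSeries

/-- Multiplication by `1 - X` takes first differences: the partial sum gains the letters `2r` and
`2r - 1`, and re-indexing the latter costs a factor `X`. -/
lemma mk_sum_even_mul (a : ℕ → ℚ) :
    (mk fun r => ∑ i ∈ Finset.range (2 * r + 1), a i) * (1 - X) =
      (mk fun r => a (2 * r)) + X * mk fun r => a (2 * r + 1) := by
  ext r
  rw [mul_sub, mul_one, mul_comm _ X]
  cases r with
  | zero => simp
  | succ r =>
    simp only [map_sub, map_add, coeff_succ_X_mul, coeff_mk]
    rw [show 2 * (r + 1) + 1 = 2 * r + 1 + 1 + 1 by ring, Finset.sum_range_succ,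
      Finset.sum_range_succ]
    rw [show 2 * (r + 1) = 2 * r + 1 + 1 by ring]
    ring

lemma mk_sum_odd_mul (a : ℕ → ℚ) :
    (mk fun r => ∑ i ∈ Finset.range (2 * r + 2), a i) * (1 - X) =
      (mk fun r => a (2 * r)) + mk fun r => a (2 * r + 1) := by
  ext r
  rw [mul_sub, mul_one, mul_comm _ X]
  cases r with
  | zero => simp [Finset.sum_range_succ]
  | succ r =>
    simp only [map_sub, map_add, coeff_succ_X_mul, coeff_mk]
    rw [show 2 * (r + 1) + 2 = 2 * r + 2 + 1 + 1 by ring, Finset.sum_range_succ,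
      Finset.sum_range_succ]
    rw [show 2 * (r + 1) = 2 * r + 1 + 1 by ring]
    ring

lemma series_of_ascent (δ : ℕ → Bool) (k : ℕ) (h : δ k = true) :
    evenSeries δ (k + 1) = oddSeries δ (k + 1) ∧
      oddSeries δ (k + 1) * (1 - X) = evenSeries δ k + X * oddSeries δ k := by
  have e : evenSeries δ (k + 1) =
      mk fun r => ∑ i ∈ Finset.range (2 * r + 1), (endCount δ k i : ℚ) := by
    ext r
    simp [evenSeries, endCount_succ_eq_sum δ k (2 * r) (by simp [h])]
  have o : oddSeries δ (k + 1) =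
      mk fun r => ∑ i ∈ Finset.range (2 * r + 1), (endCount δ k i : ℚ) := by
    ext r
    simp [oddSeries, endCount_succ_eq_sum' δ k (2 * r + 1) (by simp [h])]
  refine ⟨e.trans o.symm, ?_⟩
  rw [o, mk_sum_even_mul]
  rfl

lemma series_of_descent (δ : ℕ → Bool) (k : ℕ) (h : δ k = false) :
    evenSeries δ (k + 1) = X * oddSeries δ (k + 1) ∧
      oddSeries δ (k + 1) * (1 - X) = evenSeries δ k + oddSeries δ k := by
  have o : oddSeries δ (k + 1) =
      mk fun r => ∑ i ∈ Finset.range (2 * r + 2), (endCount δ k i : ℚ) := by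
    ext r
    simp [oddSeries, endCount_succ_eq_sum δ k (2 * r + 1) (by simp [h])]
  constructor
  · rw [o]
    ext r
    cases r with
    | zero => simp [evenSeries, endCount_succ_eq_sum' δ k 0 (by simp [h])]
    | succ r =>
      rw [evenSeries, coeff_mk, coeff_succ_X_mul, coeff_mk,
        endCount_succ_eq_sum' δ k (2 * (r + 1)) (by simp [h])]
      simp [mul_add]
  · rw [o, mk_sum_odd_mul]
    rfl

/-- A two-state induction with denominators cleared. Repeating the previous direction multiplies the
odd series by `(1 + X) / (1 - X)`, a peak by `2 / (1 - X)`, a valley by `2X / (1 - X)`. The factor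
`2 * X` in the descending state pays for the next valley in advance, so that each peak accounts for
a full `4X / (1 + X)²`. -/
lemma series_invariant (δ : ℕ → Bool) (k : ℕ) :
    (isRise δ k = true → evenSeries δ k = oddSeries δ k ∧
      oddSeries δ k * (1 - X) ^ (k + 1) * (1 + X) ^ (2 * peakCount δ k) =
        (1 + X) ^ k * (4 * X) ^ peakCount δ k) ∧
    (isRise δ k = false → evenSeries δ k = X * oddSeries δ k ∧
      2 * X * oddSeries δ k * (1 - X) ^ (k + 1) * (1 + X) ^ (2 * peakCount δ k) =
        (1 + X) ^ (k + 1) * (4 * X) ^ peakCount δ k) := by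
  induction k with
  | zero =>
    refine ⟨fun _ => ⟨by ext r; simp [evenSeries, oddSeries, endCount], ?_⟩,
      fun h => by simp [isRise] at h⟩
    have : oddSeries δ 0 = mk 1 := by ext r; simp [oddSeries, endCount]
    simp [this, peakCount, PowerSeries.mk_one_mul_one_sub_eq_one]
  | succ k ih =>
    rw [peakCount_succ]
    rcases h : δ k with _ | _
    · refine ⟨fun h' => by simp [isRise, h] at h', fun _ => ?_⟩
      obtain ⟨e, o⟩ := series_of_descent δ k h
      refine ⟨e, ?_⟩
      rcases hr : isRise δ k with _ | _
      · obtain ⟨e', o'⟩ := ih.2 hr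
        rw [e'] at o
        simp only [Bool.false_eq_true, false_and, if_false, add_zero]
        calc _ = 2 * X * (oddSeries δ (k + 1) * (1 - X)) * (1 - X) ^ (k + 1) *
              (1 + X) ^ (2 * peakCount δ k) := by ring
          _ = (1 + X) * (2 * X * oddSeries δ k * (1 - X) ^ (k + 1) *
              (1 + X) ^ (2 * peakCount δ k)) := by rw [o]; ring
          _ = _ := by rw [o']; ring
      · obtain ⟨e', o'⟩ := ih.1 hr
        rw [e'] at o
        simp only [and_self, if_true]
        calc _ = 2 * X * (oddSeries δ (k + 1) * (1 - X)) * (1 - X) ^ (k + 1) *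
              (1 + X) ^ (2 * (peakCount δ k + 1)) := by ring
          _ = 4 * X * (1 + X) ^ 2 * (oddSeries δ k * (1 - X) ^ (k + 1) *
              (1 + X) ^ (2 * peakCount δ k)) := by rw [o]; ring
          _ = _ := by rw [o']; ring
    · refine ⟨fun _ => ?_, fun h' => by simp [isRise, h] at h'⟩
      obtain ⟨e, o⟩ := series_of_ascent δ k h
      refine ⟨e, ?_⟩
      simp only [Bool.true_eq_false, and_false, if_false, add_zero]
      rcases hr : isRise δ k with _ | _
      · obtain ⟨e', o'⟩ := ih.2 hr
        rw [e'] at o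
        calc _ = (oddSeries δ (k + 1) * (1 - X)) * (1 - X) ^ (k + 1) *
              (1 + X) ^ (2 * peakCount δ k) := by ring
          _ = (2 * X * oddSeries δ k * (1 - X) ^ (k + 1) *
              (1 + X) ^ (2 * peakCount δ k)) := by rw [o]; ring
          _ = _ := by rw [o']
      · obtain ⟨e', o'⟩ := ih.1 hr
        rw [e'] at o
        calc _ = (oddSeries δ (k + 1) * (1 - X)) * (1 - X) ^ (k + 1) *
              (1 + X) ^ (2 * peakCount δ k) := by ring
          _ = (1 + X) * (oddSeries δ k * (1 - X) ^ (k + 1) *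
              (1 + X) ^ (2 * peakCount δ k)) := by rw [o]; ring
          _ = _ := by rw [o']; ring

/-- Summing over the last letter up to `2m` acts like one more ascent, so the prepaid factor `2X` of
the descending state is used up. -/
theorem sum_endCount_series (δ : ℕ → Bool) (k : ℕ) :
    (mk fun m => ∑ j ∈ Finset.range (2 * m + 1), (endCount δ k j : ℚ)) *
        ((1 - X) ^ (k + 2) * (1 + X) ^ (2 * peakCount δ k)) =
      (1 + X) ^ (k + 1) * (4 * X) ^ peakCount δ k := by
  have h := mk_sum_even_mul fun j => (endCount δ k j : ℚ)
  change _ = evenSeries δ k + X * oddSeries δ k at h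
  rw [pow_succ _ (k + 1), mul_comm _ (1 - X), mul_assoc (1 - X), ← mul_assoc, h]
  rcases hr : isRise δ k with _ | _
  · obtain ⟨e', o'⟩ := (series_invariant δ k).2 hr
    rw [e', ← o']; ring
  · obtain ⟨e', o'⟩ := (series_invariant δ k).1 hr
    rw [e', pow_succ' (1 + X) k, mul_assoc (1 + X), ← o']; ring

/-! ### Left enriched partitions of a permutation -/

/-- `w` is a left enriched partition for `π`: a weakly increasing word such that `π` increases on
the blocks of even letters and decreases on the blocks of odd letters. -/
def Good (m : ℕ) {n : ℕ} (π : Equiv.Perm (Fin n)) (w : Fin n → Fin (2 * m + 1)) : Prop :=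
  Monotone w ∧ ∀ i j, i < j → w i = w j →
    ((Even (w i : ℕ) → π i < π j) ∧ (¬ Even (w i : ℕ) → π j < π i))

/-- The ascent pattern of `π`. -/
def ascents {n : ℕ} (π : Equiv.Perm (Fin n)) (i : ℕ) : Bool :=
  decide (oneLine π (i + 1) < oneLine π (i + 2))

/-- Words all of whose consecutive pairs of letters are allowed by the pattern `δ`. -/
def Chain (δ : ℕ → Bool) {k M : ℕ} (w : Fin (k + 1) → Fin M) : Prop :=
  ∀ i : Fin k, Step (δ i) (w i.castSucc) (w i.succ)

lemma ascents_eq {k : ℕ} (π : Equiv.Perm (Fin (k + 1))) (i : Fin k) :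
    ascents π i = true ↔ π i.castSucc < π i.succ := by
  have h1 : (i : ℕ) < k + 1 := by omega
  have h2 : (i : ℕ) < k := i.2
  rw [ascents, decide_eq_true_iff]
  simp only [oneLine]
  rw [dif_pos h1, dif_pos (by omega), Fin.lt_def]
  exact Nat.succ_lt_succ_iff

/-- Positions carrying equal letters form an interval because `w` is monotone, so the comparisons of
`π` on a block follow from consecutive ones. -/
lemma good_iff_chain {m k : ℕ} (π : Equiv.Perm (Fin (k + 1))) (w : Fin (k + 1) → Fin (2 * m + 1)) :
    Good m π w ↔ Chain (ascents π) w := by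
  constructor
  · rintro ⟨hm, hg⟩ i
    rcases (hm (Fin.castSucc_lt_succ (i := i)).le).lt_or_eq with h | h
    · exact Or.inl h
    · refine Or.inr ⟨congrArg _ h, ?_⟩
      have := hg _ _ (Fin.castSucc_lt_succ (i := i)) h
      rw [ascents_eq, ← h]
      exact ⟨this.1, fun h' => by by_contra h''; exact lt_asymm h' (this.2 h'')⟩
  · intro h
    have hm : Monotone w := by
      rw [Fin.monotone_iff_le_succ]
      intro i
      rcases h i with h' | h'
      · exact Fin.le_def.2 h'.le
      · exact Fin.le_def.2 h'.1.le
    refine ⟨hm, fun i j => ?_⟩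
    induction j using Fin.induction with
    | zero => intro h'; simp at h'
    | succ j ih =>
      intro hij he
      have hij' : i ≤ j.castSucc := Fin.le_castSucc_iff.2 hij
      have h1 : w j.castSucc = w j.succ :=
        le_antisymm (hm Fin.castSucc_lt_succ.le) (he ▸ hm hij')
      have h2 : Even (w i : ℕ) ↔ ascents π j = true := by
        rcases h j with h' | h'
        · exact absurd h' (by rw [h1]; exact lt_irrefl _)
        · rw [he]; exact h'.2
      have h3 : ¬ Even (w i : ℕ) → π j.succ < π j.castSucc := by
        intro h4
        rw [h2, ascents_eq, not_lt] at h4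
        exact lt_of_le_of_ne h4 fun h5 => by
          have := π.injective h5
          exact absurd this (Fin.castSucc_lt_succ (i := j)).ne'
      rw [ascents_eq] at h2
      rcases hij'.lt_or_eq with h5 | h5
      · obtain ⟨a, b⟩ := ih h5 (he.trans h1.symm)
        exact ⟨fun e => (a e).trans (h2.1 e), fun e => (h3 e).trans (b e)⟩
      · rw [h5] at h2 h3 ⊢
        exact ⟨h2.1, h3⟩

open Classical in
lemma card_chain_last (δ : ℕ → Bool) (M k : ℕ) (j : Fin M) :
    (Finset.univ.filter fun w : Fin (k + 1) → Fin M => Chain δ w ∧ w (Fin.last k) = j).card =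
      endCount δ k j := by
  induction k generalizing j with
  | zero =>
    rw [endCount, Finset.card_eq_one]
    refine ⟨fun _ => j, ?_⟩
    ext w
    simp only [Finset.mem_filter, Finset.mem_univ, true_and, Finset.mem_singleton]
    constructor
    · rintro ⟨-, h⟩
      funext i
      rw [← h, Fin.fin_one_eq_zero i]; rfl
    · rintro rfl
      exact ⟨fun i => i.elim0, rfl⟩
  | succ k ih =>
    rw [Finset.card_eq_sum_card_fiberwise (f := fun w => w (Fin.last k).castSucc)
      (t := Finset.univ) (by simp)]
    have hsum : endCount δ (k + 1) j =
        ∑ i : Fin M, if Step (δ k) i j then endCount δ k i else 0 := by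
      rw [endCount, Fin.sum_univ_eq_sum_range
        (fun i => if Step (δ k) i j then endCount δ k i else 0) M]
      refine Finset.sum_subset (by simp) fun i _ hi => if_neg ?_
      simp only [Finset.mem_range] at hi
      rintro (h | h) <;> omega
    rw [hsum]
    refine Finset.sum_congr rfl fun i _ => ?_
    split_ifs with hs
    · rw [← ih i]
      refine Finset.card_bij' (fun w _ => Fin.init w) (fun w _ => Fin.snoc w j) ?_ ?_ ?_ ?_
      · intro w hw
        simp only [Finset.mem_filter, Finset.mem_univ, true_and] at hw ⊢
        exact ⟨fun l => hw.1.1 l.castSucc, hw.2⟩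
      · intro w hw
        simp only [Finset.mem_filter, Finset.mem_univ, true_and] at hw ⊢
        refine ⟨⟨fun l => ?_, by simp⟩, by simp [hw.2]⟩
        refine Fin.lastCases ?_ (fun l => ?_) l
        · simpa [hw.2] using hs
        · have := hw.1 l
          rw [Fin.succ_castSucc]
          simpa only [Fin.snoc_castSucc, Fin.val_castSucc] using this
      · intro w hw
        simp only [Finset.mem_filter, Finset.mem_univ, true_and] at hw
        rw [← hw.1.2]
        exact Fin.snoc_init_self w
      · intro w _
        exact Fin.init_snoc (α := fun _ => Fin M) j w
    · rw [Finset.card_eq_zero, Finset.filter_eq_empty_iff]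
      intro w hw h
      simp only [Finset.mem_filter, Finset.mem_univ, true_and] at hw
      apply hs
      have := hw.1 (Fin.last k)
      rw [h, Fin.succ_last, hw.2] at this
      simpa using this

open Classical in
lemma card_good {m k : ℕ} (π : Equiv.Perm (Fin (k + 1))) :
    (Finset.univ.filter fun w : Fin (k + 1) → Fin (2 * m + 1) => Good m π w).card =
      ∑ j ∈ Finset.range (2 * m + 1), endCount (ascents π) k j := by
  rw [Finset.card_eq_sum_card_fiberwise (f := fun w => w (Fin.last k)) (t := Finset.univ)
    (by simp), ← Fin.sum_univ_eq_sum_range]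
  refine Finset.sum_congr rfl fun j _ => ?_
  rw [← card_chain_last, Finset.filter_filter]
  simp only [good_iff_chain]

lemma lpk_eq_peakCount {k : ℕ} (π : Equiv.Perm (Fin (k + 1))) :
    lpk π = peakCount (ascents π) k := by
  unfold lpk peakCount
  symm
  -- Patterns are indexed from `0`, one-line positions from `1`; `isRise δ 0 = true` encodes the
  -- convention `π(0) = 0`.
  refine Finset.card_bij (fun j _ => j + 1) ?_ (by simp) ?_
  · intro j hj
    simp only [Finset.mem_filter, Finset.mem_range, Finset.mem_Ioo] at hj ⊢
    obtain ⟨hj, h1, h2⟩ := hj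
    have hne : oneLine π (j + 1) ≠ oneLine π (j + 2) := by
      simp only [oneLine]
      rw [dif_pos (by omega), dif_pos (by omega)]
      intro h
      have := π.injective (Fin.ext (Nat.succ_injective h))
      simp at this
    refine ⟨by omega, ?_, ?_⟩
    · cases j with
      | zero =>
        change 0 < oneLine π 1
        simp [oneLine]
      | succ j => simpa [isRise, ascents] using h1
    · simp only [ascents, decide_eq_false_iff_not, not_lt] at h2
      exact lt_of_le_of_ne h2 hne.symm
  · intro b hb
    simp only [Finset.mem_filter, Finset.mem_Ioo] at hb
    obtain ⟨⟨h0, h1⟩, h2, h3⟩ := hb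
    obtain ⟨j, rfl⟩ : ∃ j, b = j + 1 := ⟨b - 1, by omega⟩
    refine ⟨j, ?_, rfl⟩
    simp only [Finset.mem_filter, Finset.mem_range]
    refine ⟨by omega, ?_, ?_⟩
    · cases j with
      | zero => rfl
      | succ j => simpa [isRise, ascents] using h2
    · simp only [ascents, decide_eq_false_iff_not, not_lt]
      exact h3.le

open Classical in
/-- The generating function of left enriched partitions in the number of letters. -/
theorem good_series {n : ℕ} (π : Equiv.Perm (Fin n)) :
    (mk fun m => ((Finset.univ.filter fun w => Good m π w).card : ℚ)) =
      (1 + X) ^ n * ((1 - X) ^ (n + 1))⁻¹ * (4 * X * ((1 + X) ^ 2)⁻¹) ^ lpk π := by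
  have key : (mk fun m => ((Finset.univ.filter fun w => Good m π w).card : ℚ)) *
      ((1 - X) ^ (n + 1) * (1 + X) ^ (2 * lpk π)) = (1 + X) ^ n * (4 * X) ^ lpk π := by
    cases n with
    | zero =>
      have h1 : (mk fun m => ((Finset.univ.filter fun w => Good m π w).card : ℚ)) = mk 1 := by
        ext m
        have : (Finset.univ.filter fun w => Good m π w) = Finset.univ := by
          ext w
          simp only [Finset.mem_filter, Finset.mem_univ, true_and, iff_true]
          exact ⟨fun i => i.elim0, fun i => i.elim0⟩
        rw [coeff_mk, coeff_mk, this]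
        simp
      have h2 : lpk π = 0 := by simp [lpk]
      rw [h1, h2]
      simp [PowerSeries.mk_one_mul_one_sub_eq_one]
    | succ k =>
      rw [lpk_eq_peakCount, ← sum_endCount_series]
      simp only [card_good, Nat.cast_sum]
  have h1 : constantCoeff (R := ℚ) ((1 - X) ^ (n + 1)) ≠ 0 := by simp
  have h2 : constantCoeff (R := ℚ) ((1 + X) ^ 2) ≠ 0 := by simp
  have e1 := PowerSeries.mul_inv_cancel _ h1
  have e2 : ((1 + X : PowerSeries ℚ) ^ 2) ^ lpk π * (((1 + X) ^ 2)⁻¹) ^ lpk π = 1 := by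
    rw [← mul_pow, PowerSeries.mul_inv_cancel _ h2, one_pow]
  have e3 : (1 + X : PowerSeries ℚ) ^ (2 * lpk π) * (((1 + X) ^ 2)⁻¹) ^ lpk π = 1 := by
    rw [pow_mul, e2]
  calc _ = (mk fun m => ((Finset.univ.filter fun w => Good m π w).card : ℚ)) *
        (((1 - X) ^ (n + 1) * ((1 - X) ^ (n + 1))⁻¹) *
          ((1 + X) ^ (2 * lpk π) * (((1 + X) ^ 2)⁻¹) ^ lpk π)) := by rw [e1, e3]; ring
    _ = ((mk fun m => ((Finset.univ.filter fun w => Good m π w).card : ℚ)) *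
        ((1 - X) ^ (n + 1) * (1 + X) ^ (2 * lpk π))) *
          (((1 - X) ^ (n + 1))⁻¹ * (((1 + X) ^ 2)⁻¹) ^ lpk π) := by ring
    _ = _ := by rw [key, mul_pow (4 * X)]; ring

end EnrichedPartitions

/-! ### The signed lexicographic order on periodic words -/

/-- The sign of a letter: even letters are positive, odd letters negative. -/
def letterSign {m : ℕ} (a : Fin (2 * m + 1)) : ℤˣ := if Even (a : ℕ) then 1 else -1

/-- The product of the signs of the first `k` letters. -/
def prefixSign {m : ℕ} (W : ℕ → Fin (2 * m + 1)) (k : ℕ) : ℤˣ :=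
  ∏ j ∈ Finset.range k, letterSign (W j)

lemma letterSign_eq_one {m : ℕ} (a : Fin (2 * m + 1)) : letterSign a = 1 ↔ Even (a : ℕ) := by
  unfold letterSign
  split_ifs with h <;> simp [h]

lemma prefixSign_succ {m : ℕ} (W : ℕ → Fin (2 * m + 1)) (k : ℕ) :
    prefixSign W (k + 1) = prefixSign W k * letterSign (W k) := Finset.prod_range_succ _ _

lemma prefixSign_succ' {m : ℕ} (W : ℕ → Fin (2 * m + 1)) (k : ℕ) :
    prefixSign W (k + 1) = prefixSign (fun j => W (j + 1)) k * letterSign (W 0) :=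
  Finset.prod_range_succ' _ _

lemma prefixSign_add {m : ℕ} (W : ℕ → Fin (2 * m + 1)) (k l : ℕ) :
    prefixSign W (k + l) = prefixSign W k * prefixSign (fun j => W (k + j)) l :=
  Finset.prod_range_add _ _ _

lemma prefixSign_congr {m : ℕ} {W W' : ℕ → Fin (2 * m + 1)} {k : ℕ} (h : ∀ j < k, W j = W' j) :
    prefixSign W k = prefixSign W' k :=
  Finset.prod_congr rfl fun j hj => by rw [h j (by simpa using hj)]

lemma units_ne_one {s : ℤˣ} (h : s ≠ 1) : s = -1 := (Int.units_eq_one_or s).resolve_left h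

/-- Reverse the alphabet if the sign is negative. -/
def signFlip {m : ℕ} (s : ℤˣ) (a : Fin (2 * m + 1)) : Fin (2 * m + 1) := if s = 1 then a else a.rev

lemma signFlip_lt {m : ℕ} (s : ℤˣ) (a b : Fin (2 * m + 1)) :
    signFlip s a < signFlip s b ↔ if s = 1 then a < b else b < a := by
  unfold signFlip
  split_ifs <;> simp

lemma signFlip_injective {m : ℕ} (s : ℤˣ) : Function.Injective (signFlip (m := m) s) := by
  intro a b h
  unfold signFlip at h
  split_ifs at h
  · exact h
  · exact Fin.rev_injective h

/-- Infinite words that are periodic with period `L`. -/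
def Word (m L : ℕ) : Type := {W : ℕ → Fin (2 * m + 1) // ∀ k, W (k + L) = W k}

namespace Word

variable {m L : ℕ}

@[ext] lemma ext {W W' : Word m L} (h : ∀ k, W.1 k = W'.1 k) : W = W' := Subtype.ext (funext h)

lemma apply_mod (W : Word m L) (k : ℕ) : W.1 (k % L) = W.1 k := by
  exact Function.Periodic.map_mod_nat W.2 k

instance [NeZero L] : Finite (Word m L) :=
  Finite.of_injective (fun (W : Word m L) (i : Fin L) => W.1 i) fun W W' h => by
    ext k
    rw [← W.apply_mod, ← W'.apply_mod]
    exact congrArg _ (congrFun h ⟨k % L, Nat.mod_lt _ (NeZero.pos L)⟩)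

instance [NeZero L] : Fintype (Word m L) := Fintype.ofFinite _

/-- The word in which the letters preceded by a negative prefix are reversed. -/
def twist (W : Word m L) : Lex (ℕ → Fin (2 * m + 1)) :=
  toLex fun k => signFlip (prefixSign W.1 k) (W.1 k)

/-- The flip at a position depends only on earlier letters, so the letters are recovered one by one.
-/
lemma agree_of_twist {W W' : Word m L} {k : ℕ} (h : ∀ j < k, W.twist j = W'.twist j) :
    ∀ j < k, W.1 j = W'.1 j := by
  intro j
  induction j using Nat.strong_induction_on with
  | _ j ih =>
    intro hj
    have h1 := h j hj
    have h2 : prefixSign W.1 j = prefixSign W'.1 j :=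
      prefixSign_congr fun l hl => ih l hl (hl.trans hj)
    change signFlip _ _ = signFlip _ _ at h1
    rw [h2] at h1
    exact signFlip_injective _ h1

lemma twist_injective : Function.Injective (twist : Word m L → _) := by
  intro W W' h
  ext k
  rw [agree_of_twist (k := k + 1) (fun j _ => congrFun h j) k (Nat.lt_succ_self k)]

/-- The signed lexicographic order. -/
instance : LinearOrder (Word m L) := LinearOrder.lift' twist twist_injective

lemma lt_iff {W W' : Word m L} :
    W < W' ↔ ∃ k, (∀ j < k, W.1 j = W'.1 j) ∧
      if prefixSign W.1 k = 1 then W.1 k < W'.1 k else W'.1 k < W.1 k := by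
  change twist W < twist W' ↔ _
  constructor
  · rintro ⟨k, h1, h2⟩
    have h3 := agree_of_twist h1
    refine ⟨k, h3, ?_⟩
    rw [← signFlip_lt]
    change signFlip _ _ < signFlip _ _ at h2
    rwa [← prefixSign_congr h3] at h2
  · rintro ⟨k, h1, h2⟩
    refine ⟨k, fun j hj => ?_, ?_⟩
    · change signFlip _ _ = signFlip _ _
      rw [prefixSign_congr fun l hl => h1 l (hl.trans hj), h1 j hj]
    · change signFlip _ _ < signFlip _ _
      rwa [← prefixSign_congr h1, signFlip_lt]

lemma head_le {W W' : Word m L} (h : W ≤ W') : W.1 0 ≤ W'.1 0 := by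
  by_contra! h'
  exact absurd h (not_le.2 (lt_iff.2 ⟨0, by simp, by simpa [prefixSign] using h'⟩))

variable [NeZero L]

/-- The shift, which deletes the first letter. -/
def shift : Equiv.Perm (Word m L) where
  toFun W := ⟨fun k => W.1 (k + 1), fun k =>
    (congrArg W.1 (add_right_comm k L 1)).trans (W.2 (k + 1))⟩
  invFun W := ⟨fun k => W.1 (k + (L - 1)), fun k =>
    (congrArg W.1 (add_right_comm k L (L - 1))).trans (W.2 (k + (L - 1)))⟩
  left_inv W := by
    ext k
    have : k + (L - 1) + 1 = k + L := by have := NeZero.pos L; omega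
    simp [this, W.2]
  right_inv W := by
    ext k
    have : k + 1 + (L - 1) = k + L := by have := NeZero.pos L; omega
    simp [this, W.2]

lemma shift_apply (W : Word m L) (k : ℕ) : (shift W).1 k = W.1 (k + 1) := rfl

lemma shift_pow_apply (W : Word m L) (j k : ℕ) : ((shift ^ j) W).1 k = W.1 (k + j) := by
  induction j generalizing k with
  | zero => rfl
  | succ j ih => rw [pow_succ', Equiv.Perm.mul_apply, shift_apply, ih, add_assoc, add_comm 1]

/-- Deleting a common first letter multiplies all later prefix signs by its sign, which keeps or
reverses every comparison. -/
lemma lt_iff_shift {W W' : Word m L} (h : W.1 0 = W'.1 0) :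
    W < W' ↔ if letterSign (W.1 0) = 1 then shift W < shift W' else shift W' < shift W := by
  have key : W < W' ↔ ∃ k, (∀ j < k, (shift W).1 j = (shift W').1 j) ∧
      if prefixSign (shift W).1 k * letterSign (W.1 0) = 1 then
        (shift W).1 k < (shift W').1 k else (shift W').1 k < (shift W).1 k := by
    rw [lt_iff]
    constructor
    · rintro ⟨k, h1, h2⟩
      cases k with
      | zero => simp [h] at h2
      | succ k =>
        rw [prefixSign_succ'] at h2
        exact ⟨k, fun j hj => h1 (j + 1) (by omega), h2⟩
    · rintro ⟨k, h1, h2⟩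
      refine ⟨k + 1, fun j hj => ?_, ?_⟩
      · cases j with
        | zero => exact h
        | succ j => exact h1 j (by omega)
      · rw [prefixSign_succ']
        exact h2
  rw [key]
  split_ifs with hs
  · rw [lt_iff]
    simp [hs]
  · rw [lt_iff, units_ne_one hs]
    refine exists_congr fun k => ?_
    constructor
    · rintro ⟨h1, h2⟩
      refine ⟨fun j hj => (h1 j hj).symm, ?_⟩
      rw [← prefixSign_congr h1]
      rcases Int.units_eq_one_or (prefixSign (shift W).1 k) with h3 | h3 <;> simpa [h3] using h2
    · rintro ⟨h1, h2⟩
      refine ⟨fun j hj => (h1 j hj).symm, ?_⟩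
      rw [prefixSign_congr h1] at h2
      rcases Int.units_eq_one_or (prefixSign (shift W).1 k) with h3 | h3 <;> simpa [h3] using h2

end Word

/-! ### Itineraries, and injectivity of the correspondence -/

variable {m n : ℕ}

instance : NeZero n.factorial := ⟨n.factorial_ne_zero⟩

/-- Makes `n!` a common period, so that the itineraries of all permutations of `Fin n` lie in one
finite type of words. -/
lemma perm_pow_factorial (π : Equiv.Perm (Fin n)) : π ^ n.factorial = 1 := by
  have := pow_card_eq_one (x := π)
  rwa [Fintype.card_perm, Fintype.card_fin] at this

/-- The letters met along the orbit of a point. -/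
def itinerary (π : Equiv.Perm (Fin n)) (w : Fin n → Fin (2 * m + 1)) (i : Fin n) :
    Word m n.factorial :=
  ⟨fun k => w ((π ^ k) i), fun k => by simp [pow_add, perm_pow_factorial]⟩

lemma itinerary_apply (π : Equiv.Perm (Fin n)) (w : Fin n → Fin (2 * m + 1)) (i : Fin n) :
    itinerary π w (π i) = Word.shift (itinerary π w i) := by
  ext k
  rw [Word.shift_apply]
  change ((w ((π ^ k) (π i)) : Fin _) : ℕ) = w ((π ^ (k + 1)) i)
  rw [pow_succ, Equiv.Perm.mul_apply]

lemma itinerary_pow_apply (π : Equiv.Perm (Fin n)) (w : Fin n → Fin (2 * m + 1)) (i : Fin n)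
    (k : ℕ) : itinerary π w ((π ^ k) i) = (Word.shift ^ k) (itinerary π w i) := by
  induction k with
  | zero => rfl
  | succ k ih => rw [pow_succ', pow_succ', Equiv.Perm.mul_apply, itinerary_apply, ih]; rfl

namespace Good

variable {π π' : Equiv.Perm (Fin n)} {w w' : Fin n → Fin (2 * m + 1)}

/-- While the letters agree, each application of `π` preserves or reverses the order according to
the sign of the current letter; the reversals accumulate to the prefix sign. -/
lemma pow_lt (hg : Good m π w) {i j : Fin n} (hij : i < j) (k : ℕ)
    (h : ∀ l < k, w ((π ^ l) i) = w ((π ^ l) j)) :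
    if prefixSign (itinerary π w i).1 k = 1 then (π ^ k) i < (π ^ k) j
      else (π ^ k) j < (π ^ k) i := by
  induction k with
  | zero => simpa [prefixSign] using hij
  | succ k ih =>
    specialize ih fun l hl => h l (by omega)
    have he := h k (Nat.lt_succ_self k)
    have e1 : letterSign ((itinerary π w i).1 k) = 1 ↔ Even (w ((π ^ k) i) : ℕ) :=
      letterSign_eq_one _
    rw [prefixSign_succ, pow_succ', Equiv.Perm.mul_apply, Equiv.Perm.mul_apply]
    rcases Int.units_eq_one_or (prefixSign (itinerary π w i).1 k) with h1 | h1
    · rw [h1] at ih ⊢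
      rw [one_mul]
      have := hg.2 _ _ (by simpa using ih) he
      split_ifs with h2
      · exact this.1 (e1.1 h2)
      · exact this.2 (mt e1.2 h2)
    · rw [h1] at ih ⊢
      have := hg.2 _ _ (by simpa using ih) he.symm
      rw [← he] at this
      rcases Int.units_eq_one_or (letterSign ((itinerary π w i).1 k)) with h2 | h2
      · have h3 := e1.1 h2
        simpa [h2] using this.1 h3
      · have h3 := mt e1.2 (by rw [h2]; decide)
        simpa [h2] using this.2 h3

/-- At the first disagreement of two itineraries, `pow_lt` orders the two image points, and
monotonicity of `w` transfers this to the letters. -/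
lemma itinerary_monotone (hg : Good m π w) : Monotone (itinerary π w) := by
  intro i j hij
  rcases hij.eq_or_lt with rfl | hij
  · exact le_rfl
  by_contra! h
  obtain ⟨k, h1, h2⟩ := Word.lt_iff.1 h
  rw [prefixSign_congr h1] at h2
  have := hg.pow_lt hij k fun l hl => (h1 l hl).symm
  split_ifs at h2 this with h3
  · exact absurd h2 (not_lt.2 (hg.1 this.le))
  · exact absurd h2 (not_lt.2 (hg.1 this.le))

end Good

lemma monotone_eq_of_card_fiber {α : Type*} [LinearOrder α] {f g : Fin n → α} (hf : Monotone f)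
    (hg : Monotone g)
    (h : ∀ a, (Finset.univ.filter fun i => f i = a).card =
      (Finset.univ.filter fun i => g i = a).card) : f = g := by
  apply List.ofFn_injective
  refine List.Perm.eq_of_sortedLE hf.sortedLE_ofFn hg.sortedLE_ofFn ?_
  rw [← Multiset.coe_eq_coe, ← Fin.univ_val_map, ← Fin.univ_val_map]
  ext a
  rw [Multiset.count_map, Multiset.count_map]
  simpa only [Finset.card_def, Finset.filter_val, eq_comm] using h a

lemma perm_eq_one_of_strictMono {α : Type*} [LinearOrder α] [WellFoundedLT α] (g : Equiv.Perm α)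
    (h : StrictMono g) : g = 1 := by
  have : StrictMono.orderIsoOfSurjective g h g.surjective = OrderIso.refl α :=
    Subsingleton.elim _ _
  ext x
  exact congrArg (fun e : α ≃o α => e x) this

/-- A monotone map from `Fin n` is determined by its fibre sizes, so the itineraries agree, and `w`
consists of their first letters. Then `π'⁻¹ * π` preserves itineraries, and on a fibre `π` and `π'`
are both increasing or both decreasing; the composite is strictly increasing, hence trivial. -/
lemma Good.eq_of_card_fiber {π π' : Equiv.Perm (Fin n)} {w w' : Fin n → Fin (2 * m + 1)}
    (hg : Good m π w) (hg' : Good m π' w')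
    (h : ∀ W, (Finset.univ.filter fun i => itinerary π w i = W).card =
      (Finset.univ.filter fun i => itinerary π' w' i = W).card) : π = π' ∧ w = w' := by
  have hI := monotone_eq_of_card_fiber hg.itinerary_monotone hg'.itinerary_monotone h
  have hw : w = w' := by
    funext i
    exact congrArg (fun W : Word m n.factorial => W.1 0) (congrFun hI i)
  subst hw
  refine ⟨?_, rfl⟩
  have hcancel : ∀ x, π' (π'⁻¹ x) = x := π'.apply_symm_apply
  have hinv : ∀ i, itinerary π w (π'⁻¹ (π i)) = itinerary π w i := by
    intro i
    apply Word.shift.injective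
    rw [hI, ← itinerary_apply, hcancel, ← hI, itinerary_apply]
  have hmono : StrictMono (π'⁻¹ * π) := by
    intro i j hij
    simp only [Equiv.Perm.mul_apply]
    rcases (hg.itinerary_monotone hij.le).lt_or_eq with h1 | h1
    · rw [← hinv i, ← hinv j] at h1
      exact hg.itinerary_monotone.reflect_lt h1
    · have hhead : ∀ a b, itinerary π w a = itinerary π w b → w a = w b := fun a b hab =>
        congrArg (fun W : Word m n.factorial => W.1 0) hab
      by_contra! h2
      have hne : π'⁻¹ (π j) ≠ π'⁻¹ (π i) := by
        intro h3
        exact hij.ne' (π.injective (π'⁻¹.injective h3))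
      have a1 := hg.2 i j hij (hhead _ _ h1)
      have a2 := hg'.2 _ _ (lt_of_le_of_ne h2 hne)
        (hhead _ _ (by rw [hinv, hinv, h1]))
      rw [hcancel, hcancel,
        hhead _ _ (hinv j), ← hhead _ _ h1] at a2
      by_cases he : Even (w i : ℕ)
      · exact lt_asymm (a1.1 he) (a2.1 he)
      · exact lt_asymm (a1.2 he) (a2.2 he)
  exact (inv_mul_eq_one.1 (perm_eq_one_of_strictMono _ hmono)).symm

/-! ### The inverse construction -/

/-- Reverse the order on `{0, …, C - 1}` if the sign is negative. -/
def flipIdx (s : ℤˣ) (C j : ℕ) : ℕ := if s = 1 then j else C - 1 - j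

lemma flipIdx_lt (s : ℤˣ) {C j : ℕ} (h : j < C) : flipIdx s C j < C := by
  unfold flipIdx
  split_ifs <;> omega

lemma flipIdx_injOn {s : ℤˣ} {C i j : ℕ} (hi : i < C) (hj : j < C)
    (h : flipIdx s C i = flipIdx s C j) : i = j := by
  unfold flipIdx at h
  split_ifs at h <;> omega

section Construction

variable {L : ℕ} [NeZero L] (c : Word m L → ℕ)

/-- Copies of the words, `c W` of each word `W`, in lexicographic order. -/
abbrev Copies : Type := {x : Word m L ×ₗ ℕ // (ofLex x).2 < c (ofLex x).1}

/-- The word of which `x` is a copy. -/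
abbrev Copies.word {c : Word m L → ℕ} (x : Copies c) : Word m L := (ofLex x.1).1

/-- The index of the copy `x`. -/
abbrev Copies.idx {c : Word m L → ℕ} (x : Copies c) : ℕ := (ofLex x.1).2

omit [NeZero L] in
lemma Copies.ext {x y : Copies c} (h1 : x.word = y.word) (h2 : x.idx = y.idx) : x = y :=
  Subtype.ext (ofLex.injective (Prod.ext h1 h2))

omit [NeZero L] in
lemma Copies.lt_iff {x y : Copies c} :
    x < y ↔ x.word < y.word ∨ x.word = y.word ∧ x.idx < y.idx :=
  Prod.Lex.lt_iff

/-- Copies of words as a sigma type. -/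
def copiesEquiv : Copies c ≃ Σ W : Word m L, Fin (c W) where
  toFun x := ⟨x.word, ⟨x.idx, x.2⟩⟩
  invFun y := ⟨toLex (y.1, y.2), y.2.2⟩
  left_inv _ := rfl
  right_inv _ := rfl

instance : Fintype (Copies c) := Fintype.ofEquiv _ (copiesEquiv c).symm

lemma card_copies : Fintype.card (Copies c) = ∑ W, c W := by
  rw [Fintype.card_congr (copiesEquiv c)]
  simp

lemma card_copies_word (W : Word m L) :
    (Finset.univ.filter fun x : Copies c => x.word = W).card = c W := by
  rw [← Fintype.card_fin (c W), ← Finset.card_univ]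
  symm
  refine Finset.card_bij (fun j _ => ⟨toLex (W, j), j.2⟩)
    (fun j _ => by simp [Copies.word]) ?_ ?_
  · intro a _ b _ h
    have := congrArg Copies.idx h
    exact Fin.ext this
  · rintro x hx
    simp only [Finset.mem_filter, Finset.mem_univ, true_and] at hx
    subst hx
    exact ⟨⟨x.idx, x.2⟩, Finset.mem_univ _, rfl⟩

variable {c} (hc : ∀ W, c (Word.shift W) = c W)

/-- The shift on copies of words, reversing the order of the copies at negative letters. -/
def copiesShiftFun (x : Copies c) : Copies c :=
  ⟨toLex (Word.shift x.word, flipIdx (letterSign (x.word.1 0)) (c x.word) x.idx), by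
      change flipIdx _ _ _ < c (Word.shift _)
      rw [hc]
      exact flipIdx_lt _ x.2⟩

lemma copiesShiftFun_injective : Function.Injective (copiesShiftFun hc) := by
  intro x y h
  have h1 : x.word = y.word := Word.shift.injective (congrArg Copies.word h)
  have h2 := congrArg Copies.idx h
  change flipIdx _ _ _ = flipIdx _ _ _ at h2
  refine Copies.ext c h1 ?_
  have hx : x.idx < c x.word := x.2
  rw [h1] at hx h2
  exact flipIdx_injOn hx y.2 h2

/-- The shift on copies of words, as a permutation. -/
def copiesShift : Equiv.Perm (Copies c) :=
  Equiv.ofBijective _ (Finite.injective_iff_bijective.1 (copiesShiftFun_injective hc))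

lemma copiesShift_word (x : Copies c) : (copiesShift hc x).word = Word.shift x.word := rfl

lemma copiesShift_pow_word (x : Copies c) (k : ℕ) :
    ((copiesShift hc ^ k) x).word = (Word.shift ^ k) x.word := by
  induction k with
  | zero => rfl
  | succ k ih => rw [pow_succ', pow_succ', Equiv.Perm.mul_apply, copiesShift_word, ih]; rfl

/-- This is the block condition of `Good` for the shift. Copies of different words are handled by
`Word.lt_iff_shift`, copies of the same word by the index flip. -/
lemma copiesShift_lt {x y : Copies c} (hxy : x < y) (h : x.word.1 0 = y.word.1 0) :
    if letterSign (x.word.1 0) = 1 then copiesShift hc x < copiesShift hc y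
      else copiesShift hc y < copiesShift hc x := by
  rcases (Copies.lt_iff c).1 hxy with h1 | ⟨h1, h2⟩
  · rw [Word.lt_iff_shift h] at h1
    split_ifs at h1 ⊢
    · exact (Copies.lt_iff c).2 (Or.inl h1)
    · exact (Copies.lt_iff c).2 (Or.inl h1)
  · have hx : x.idx < c x.word := x.2
    have hy : y.idx < c y.word := y.2
    split_ifs with h3
    · refine (Copies.lt_iff c).2 (Or.inr ⟨congrArg Word.shift h1, ?_⟩)
      change flipIdx _ _ _ < flipIdx _ _ _
      rw [← h, flipIdx, flipIdx, if_pos h3, if_pos h3]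
      exact h2
    · refine (Copies.lt_iff c).2 (Or.inr ⟨congrArg Word.shift h1.symm, ?_⟩)
      change flipIdx _ _ _ < flipIdx _ _ _
      rw [← h, flipIdx, flipIdx, if_neg h3, if_neg h3, h1]
      rw [h1] at hx
      omega

end Construction

/-- Line up the copies in order, transport the shift to `Fin n` along the order isomorphism and let
`w` record first letters; the itinerary of a copy is then its own word. -/
lemma exists_good (c : Word m n.factorial → ℕ) (hc : ∀ W, c (Word.shift W) = c W)
    (hn : ∑ W, c W = n) :
    ∃ (π : Equiv.Perm (Fin n)) (w : Fin n → Fin (2 * m + 1)), Good m π w ∧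
      ∀ W, (Finset.univ.filter fun i => itinerary π w i = W).card = c W := by
  let e : Fin n ≃o Copies c := Fintype.orderIsoFinOfCardEq _ ((card_copies c).trans hn)
  let π : Equiv.Perm (Fin n) := (e.toEquiv.trans (copiesShift hc)).trans e.symm.toEquiv
  let w : Fin n → Fin (2 * m + 1) := fun i => (e i).word.1 0
  have hπ : ∀ i, e (π i) = copiesShift hc (e i) := fun i => e.apply_symm_apply _
  have hπk : ∀ k i, e ((π ^ k) i) = (copiesShift hc ^ k) (e i) := by
    intro k i
    induction k with
    | zero => rfl
    | succ k ih => rw [pow_succ', pow_succ', Equiv.Perm.mul_apply, hπ, ih]; rfl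
  have hI : ∀ i, itinerary π w i = (e i).word := by
    intro i
    ext k
    change (((e ((π ^ k) i)).word.1 0 : Fin _) : ℕ) = _
    rw [hπk, copiesShift_pow_word, Word.shift_pow_apply, zero_add]
  refine ⟨π, w, ⟨?_, ?_⟩, ?_⟩
  · intro i j hij
    rcases hij.eq_or_lt with rfl | hij
    · exact le_rfl
    apply Word.head_le
    rcases (Copies.lt_iff c).1 (e.lt_iff_lt.2 hij) with h | h
    · exact h.le
    · exact h.1.le
  · intro i j hij h
    have := copiesShift_lt hc (e.lt_iff_lt.2 hij) h
    rw [← hπ, ← hπ, e.lt_iff_lt, e.lt_iff_lt] at this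
    have e1 : letterSign ((e i).word.1 0) = 1 ↔ Even (w i : ℕ) := letterSign_eq_one _
    split_ifs at this with h1
    · exact ⟨fun _ => this, fun h2 => absurd (e1.1 h1) h2⟩
    · exact ⟨fun h2 => absurd (e1.2 h2) h1, fun _ => this⟩
  · intro W
    rw [← card_copies_word c W]
    refine Finset.card_equiv e.toEquiv fun i => ?_
    simp [hI]

/-! ### Cycle lengths as minimal periods -/

open Function (minimalPeriod)

section Perm

variable {α : Type*}

lemma pow_apply_eq_iff_minimalPeriod_dvd (f : Equiv.Perm α) (x : α) (k : ℕ) :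
    (f ^ k) x = x ↔ minimalPeriod f x ∣ k := by
  rw [← Function.isPeriodicPt_iff_minimalPeriod_dvd, Function.IsPeriodicPt,
    Equiv.Perm.iterate_eq_pow]
  rfl

lemma minimalPeriod_pos [Finite α] (f : Equiv.Perm α) (x : α) : 0 < minimalPeriod f x :=
  Function.minimalPeriod_pos_of_mem_periodicPts (f.injective.mem_periodicPts x)

lemma _root_.Equiv.Perm.IsCycleOn.card_eq_minimalPeriod {f : Equiv.Perm α} {s : Finset α}
    (hf : f.IsCycleOn s) {x : α} (hx : x ∈ s) : s.card = minimalPeriod f x := by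
  apply Nat.dvd_antisymm
  · rw [← hf.pow_apply_eq hx, pow_apply_eq_iff_minimalPeriod_dvd]
  · rw [← pow_apply_eq_iff_minimalPeriod_dvd, hf.pow_apply_eq hx]

open Classical in
lemma card_sameCycle [Fintype α] (f : Equiv.Perm α) (x : α) :
    (Finset.univ.filter fun y => f.SameCycle x y).card = minimalPeriod f x := by
  refine Equiv.Perm.IsCycleOn.card_eq_minimalPeriod ⟨?_, ?_⟩
    (by simpa using Equiv.Perm.SameCycle.refl f x)
  · refine f.bijOn fun y => ?_
    simp
  · intro y hy z hz
    simp only [Finset.coe_filter, Finset.mem_univ, true_and, Set.mem_ofPred_eq] at hy hz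
    exact hy.symm.trans hz

lemma eq_of_sameCycle [Finite α] {β : Type*} {f : Equiv.Perm α} {g : α → β}
    (h : ∀ x, g (f x) = g x) {x y : α} (hxy : f.SameCycle x y) : g x = g y := by
  obtain ⟨k, -, rfl⟩ := hxy.exists_pow_eq'
  clear hxy
  induction k with
  | zero => rfl
  | succ k ih => rw [pow_succ', Equiv.Perm.mul_apply, h, ih]

lemma minimalPeriod_apply_perm [Finite α] (f : Equiv.Perm α) (x : α) :
    minimalPeriod f (f x) = minimalPeriod f x :=
  Function.minimalPeriod_apply (f.injective.mem_periodicPts x)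

end Perm

/-- Counts points instead of cycles, to match fibres of itineraries. The case `i = 1` is separate
because `cycleType` omits fixed points and `partition` adds them back. -/
lemma mul_cycleCount {n : ℕ} (π : Equiv.Perm (Fin n)) (i : ℕ+) :
    (i : ℕ) * cycleCount i π =
      (Finset.univ.filter fun x => minimalPeriod π x = (i : ℕ)).card := by
  rw [cycleCount, Equiv.Perm.parts_partition, Multiset.count_add, Multiset.count_replicate]
  rcases eq_or_ne (i : ℕ) 1 with hi | hi
  · have h1 : Multiset.count 1 π.cycleType = 0 := by
      rw [Multiset.count_eq_zero]
      intro h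
      exact absurd (Equiv.Perm.one_lt_of_mem_cycleType h) (lt_irrefl _)
    rw [hi, h1, if_pos rfl, zero_add, one_mul, ← Finset.card_compl]
    congr 1
    ext x
    simp [Function.minimalPeriod_eq_one_iff_isFixedPt, Function.IsFixedPt]
  · rw [if_neg (Ne.symm hi), add_zero, Equiv.Perm.cycleType_def, Multiset.count_map]
    have key : ∀ x, π x ≠ x → (π.cycleOf x).support.card = minimalPeriod π x := fun x hx =>
      (π.isCycleOn_support_cycleOf x).card_eq_minimalPeriod
        (by rw [Equiv.Perm.mem_support_cycleOf_iff' hx])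
    have hne : ∀ x, minimalPeriod π x = (i : ℕ) → π x ≠ x := fun x hx h => by
      rw [Function.minimalPeriod_eq_one_iff_isFixedPt.2 h] at hx
      exact hi hx.symm
    rw [Finset.card_eq_sum_card_fiberwise (f := π.cycleOf)
      (t := π.cycleFactorsFinset.filter fun σ => (i : ℕ) = σ.support.card)]
    · rw [Finset.sum_congr rfl (g := fun _ => (i : ℕ)), Finset.sum_const, smul_eq_mul, mul_comm]
      · rfl
      · intro σ hσ
        rw [Finset.mem_filter] at hσ
        conv_rhs => rw [hσ.2]
        congr 1
        ext x
        rw [← Equiv.Perm.eq_cycleOf_of_mem_cycleFactorsFinset_iff _ _ hσ.1]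
        simp only [Finset.mem_filter, Finset.mem_univ, true_and]
        constructor
        · exact fun h => h.2.symm
        · intro h
          refine ⟨?_, h.symm⟩
          have hx : π x ≠ x := by
            rw [← Equiv.Perm.mem_support, ← Equiv.Perm.cycleOf_mem_cycleFactorsFinset_iff, ← h]
            exact hσ.1
          rw [← key x hx, ← h, hσ.2]
    · intro x hx
      simp only [Finset.coe_filter, Finset.mem_univ, true_and, Set.mem_ofPred_eq] at hx ⊢
      refine ⟨?_, ?_⟩
      · rw [Equiv.Perm.cycleOf_mem_cycleFactorsFinset_iff, Equiv.Perm.mem_support]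
        exact hne x hx
      · rw [key x (hne x hx), hx]

/-! ### Signs of words and the return map on a fibre -/

namespace Word

variable {m L : ℕ} [NeZero L]

/-- The sign of a word is the product of its letters over a minimal period. -/
def sign (W : Word m L) : ℤˣ := prefixSign W.1 (minimalPeriod shift W)

lemma prefixSign_period_mul {W : Word m L} {p : ℕ} (h : (shift ^ p) W = W) (k : ℕ) :
    prefixSign W.1 (p * k) = prefixSign W.1 p ^ k := by
  induction k with
  | zero => simp [prefixSign]
  | succ k ih =>
    have h1 : ∀ j, W.1 (p + j) = W.1 j := fun j => by
      have := shift_pow_apply W p j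
      rw [h] at this
      exact (congrArg W.1 (add_comm p j)).trans this.symm
    rw [pow_succ', ← ih, show p * (k + 1) = p + p * k by ring, prefixSign_add]
    exact congrArg _ (prefixSign_congr fun j _ => h1 j)

lemma prefixSign_of_dvd (W : Word m L) {k : ℕ} (h : minimalPeriod shift W ∣ k) :
    prefixSign W.1 k = W.sign ^ (k / minimalPeriod shift W) := by
  obtain ⟨j, rfl⟩ := h
  rw [prefixSign_period_mul ((pow_apply_eq_iff_minimalPeriod_dvd _ _ _).2 dvd_rfl),
    Nat.mul_div_cancel_left _ (minimalPeriod_pos _ _)]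
  rfl

lemma sign_shift (W : Word m L) : (shift W).sign = W.sign := by
  unfold sign
  rw [minimalPeriod_apply_perm]
  have h1 := prefixSign_succ W.1 (minimalPeriod shift W)
  rw [prefixSign_succ'] at h1
  have h2 : W.1 (minimalPeriod shift W) = W.1 0 := by
    have := shift_pow_apply W (minimalPeriod shift W) 0
    rw [(pow_apply_eq_iff_minimalPeriod_dvd _ _ _).2 dvd_rfl, zero_add] at this
    exact this.symm
  rw [h2] at h1
  exact mul_right_cancel h1

end Word

lemma Good.pow_lt_pow_of_itinerary_eq {m n : ℕ} {π : Equiv.Perm (Fin n)}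
    {w : Fin n → Fin (2 * m + 1)} (hg : Good m π w) {x y : Fin n} (hxy : x < y)
    (h : itinerary π w x = itinerary π w y) (k : ℕ) :
    if prefixSign (itinerary π w x).1 k = 1 then (π ^ k) x < (π ^ k) y
      else (π ^ k) y < (π ^ k) x :=
  hg.pow_lt hxy k fun l _ => congrArg (fun W : Word m n.factorial => W.1 l) h

/-- The square is strictly increasing, hence the identity. Two fixed points would contradict order
reversal, and the fixed points of an involution have the parity of the whole set. -/
lemma card_fixed_of_strictAnti {α : Type*} [LinearOrder α] [Fintype α] (g : Equiv.Perm α)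
    (h : StrictAnti g) :
    g * g = 1 ∧ (Finset.univ.filter fun x => g x = x).card = Fintype.card α % 2 := by
  have h1 : g * g = 1 := perm_eq_one_of_strictMono _ (h.comp h)
  refine ⟨h1, ?_⟩
  have h2 : (Finset.univ.filter fun x => g x = x).card ≤ 1 := by
    rw [Finset.card_le_one]
    intro a ha b hb
    simp only [Finset.mem_filter, Finset.mem_univ, true_and] at ha hb
    rcases lt_trichotomy a b with hab | hab | hab
    · have := h hab
      rw [ha, hb] at this
      exact absurd this (lt_asymm hab)
    · exact hab
    · have := h hab
      rw [ha, hb] at this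
      exact absurd this (lt_asymm hab)
  have h3 := Equiv.Perm.card_fixedPoints_modEq (f := (g : α → α)) (p := 2) (n := 1)
    (congrArg (fun e : Equiv.Perm α => (e : α → α)) h1)
  have h4 : Fintype.card (Function.fixedPoints (g : α → α)) =
      (Finset.univ.filter fun x => g x = x).card := Fintype.card_subtype _
  rw [h4] at h3
  rw [h3]
  exact (Nat.mod_eq_of_lt (by omega)).symm

/-- The number of points whose cycle has length `i`, in a fibre of `c` points over a word of
period `p` and sign `s`. -/
def fiberCount (s : ℤˣ) (p c i : ℕ) : ℕ :=
  if s = 1 then (if p = i then c else 0)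
  else (if p = i then c % 2 else 0) + (if 2 * p = i then 2 * (c / 2) else 0)

/-- With `p` the period of `W`, the power `π ^ p` acts on the fibre over `W`. If the sign is
positive it is increasing, hence trivial, and all periods equal `p`. If negative, it is an
order-reversing involution: its `c % 2` fixed points have period `p`, all other points `2 * p`. -/
lemma card_fiber_minimalPeriod {m n : ℕ} {π : Equiv.Perm (Fin n)} {w : Fin n → Fin (2 * m + 1)}
    (hg : Good m π w) (W : Word m n.factorial) (i : ℕ) :
    (Finset.univ.filter fun x => itinerary π w x = W ∧ minimalPeriod π x = i).card =
      fiberCount W.sign (minimalPeriod Word.shift W)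
        (Finset.univ.filter fun x => itinerary π w x = W).card i := by
  set p := minimalPeriod Word.shift W with hp
  have hp0 : 0 < p := minimalPeriod_pos _ _
  have hpow : ∀ x, itinerary π w ((π ^ p) x) = W ↔ itinerary π w x = W := by
    intro x
    rw [itinerary_pow_apply]
    have hW : (Word.shift ^ p) W = W := (pow_apply_eq_iff_minimalPeriod_dvd _ _ _).2 dvd_rfl
    constructor
    · intro h
      rw [← hW] at h
      exact (Word.shift ^ p).injective h
    · intro h
      rw [h, hW]
  let g : Equiv.Perm {x // itinerary π w x = W} := (π ^ p).subtypePerm hpow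
  have hdvd : ∀ x, itinerary π w x = W → p ∣ minimalPeriod π x := by
    rintro x rfl
    rw [hp, ← pow_apply_eq_iff_minimalPeriod_dvd, ← itinerary_pow_apply,
      (pow_apply_eq_iff_minimalPeriod_dvd _ _ _).2 dvd_rfl]
  have hlt : ∀ x y : {x // itinerary π w x = W}, x < y →
      if W.sign = 1 then g x < g y else g y < g x := by
    rintro ⟨x, hx⟩ ⟨y, hy⟩ hxy
    have := hg.pow_lt_pow_of_itinerary_eq hxy (hx.trans hy.symm) p
    rw [hx] at this
    exact this
  have hg_iff : ∀ x : {x // itinerary π w x = W}, g x = x ↔ minimalPeriod π x.1 = p := by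
    rintro ⟨x, hx⟩
    have : g ⟨x, hx⟩ = ⟨x, hx⟩ ↔ (π ^ p) x = x := by
      rw [Subtype.ext_iff]
      rfl
    rw [this, pow_apply_eq_iff_minimalPeriod_dvd]
    exact ⟨fun h => Nat.dvd_antisymm h (hdvd x hx), fun h => h.dvd⟩
  unfold fiberCount
  by_cases hs : W.sign = 1
  · simp only [hs, if_true] at hlt ⊢
    have h1 : g = 1 := perm_eq_one_of_strictMono g fun x y => hlt x y
    have h2 : ∀ x, itinerary π w x = W → minimalPeriod π x = p := fun x hx =>
      (hg_iff ⟨x, hx⟩).1 (by rw [h1]; rfl)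
    split_ifs with hi
    · congr 1
      refine Finset.filter_congr fun x _ => ?_
      exact ⟨fun h => h.1, fun h => ⟨h, (h2 x h).trans hi⟩⟩
    · rw [Finset.card_eq_zero, Finset.filter_eq_empty_iff]
      rintro x - ⟨h3, h4⟩
      exact hi ((h2 x h3).symm.trans h4)
  · simp only [hs, if_false] at hlt ⊢
    obtain ⟨h1, h2⟩ := card_fixed_of_strictAnti g fun x y => hlt x y
    have hc : Fintype.card {x // itinerary π w x = W} =
        (Finset.univ.filter fun x => itinerary π w x = W).card := Fintype.card_subtype _
    rw [hc] at h2
    have h3 : (Finset.univ.filter fun x => itinerary π w x = W ∧ minimalPeriod π x = p).card =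
        (Finset.univ.filter fun x => itinerary π w x = W).card % 2 := by
      rw [← h2, ← Finset.card_map (Function.Embedding.subtype _)]
      congr 1
      ext x
      simp only [Finset.mem_filter, Finset.mem_univ, true_and, Finset.mem_map, hg_iff,
        Function.Embedding.subtype_apply, Subtype.exists, exists_and_left, exists_prop,
        exists_eq_right_right]
      tauto
    have h4 : ∀ x, itinerary π w x = W → minimalPeriod π x = p ∨ minimalPeriod π x = 2 * p := by
      intro x hx
      have h5 : minimalPeriod π x ∣ 2 * p := by
        rw [← pow_apply_eq_iff_minimalPeriod_dvd, two_mul, pow_add]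
        have := congrArg (fun e : Equiv.Perm {x // itinerary π w x = W} => (e ⟨x, hx⟩).1) h1
        exact this
      obtain ⟨k, hk⟩ := hdvd x hx
      rw [hk, mul_comm 2 p] at h5
      have h6 := Nat.dvd_of_mul_dvd_mul_left hp0 h5
      rcases (Nat.dvd_prime Nat.prime_two).1 h6 with rfl | rfl
      · left; omega
      · right; omega
    rcases eq_or_ne p i with rfl | hi
    · rw [h3, if_pos rfl, if_neg (by omega), add_zero]
    · rw [if_neg hi, zero_add]
      split_ifs with hi2
      · have h5 := Finset.card_filter_add_card_filter_not
          (s := Finset.univ.filter fun x => itinerary π w x = W) (fun x => minimalPeriod π x = p)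
        rw [Finset.filter_filter, Finset.filter_filter, h3] at h5
        have h6 : (Finset.univ.filter fun x =>
            itinerary π w x = W ∧ ¬ minimalPeriod π x = p) =
            Finset.univ.filter fun x => itinerary π w x = W ∧ minimalPeriod π x = i := by
          refine Finset.filter_congr fun x _ => and_congr_right fun hx => ?_
          rcases h4 x hx with h | h <;> omega
        rw [h6] at h5
        omega
      · rw [Finset.card_eq_zero, Finset.filter_eq_empty_iff]
        rintro x - ⟨h5, h6⟩
        rcases h4 x h5 with h | h
        · exact hi (h.symm.trans h6)
        · exact hi2 (h.symm.trans h6)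

/-! ### Necklaces and their multiplicities -/

/-- Primitive necklaces: the cycles of the shift. -/
def Necklace (m L : ℕ) [NeZero L] : Type :=
  Quotient (Equiv.Perm.SameCycle.setoid (Word.shift : Equiv.Perm (Word m L)))

namespace Necklace

variable {m L : ℕ} [NeZero L]

instance : Finite (Necklace m L) := Quotient.finite _

instance : Fintype (Necklace m L) := Fintype.ofFinite _

instance : DecidableEq (Necklace m L) := Classical.decEq _

/-- The necklace of a word. -/
def mk (W : Word m L) : Necklace m L := Quotient.mk _ W

lemma mk_surjective : Function.Surjective (mk : Word m L → _) := Quotient.mk_surjective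

lemma mk_eq_iff {W W' : Word m L} : mk W = mk W' ↔ Word.shift.SameCycle W W' := Quotient.eq

lemma mk_shift (W : Word m L) : mk (Word.shift W) = mk W :=
  mk_eq_iff.2 (Equiv.Perm.sameCycle_apply_left.2 (Equiv.Perm.SameCycle.refl _ _))

/-- Lift a shift-invariant function to necklaces. -/
def lift {β : Type*} (g : Word m L → β) (h : ∀ W, g (Word.shift W) = g W) : Necklace m L → β :=
  Quotient.lift g fun _ _ hab => eq_of_sameCycle h hab

/-- The length of a necklace. -/
def len : Necklace m L → ℕ := lift (minimalPeriod Word.shift) (minimalPeriod_apply_perm _)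

/-- The sign of a necklace. -/
def sign : Necklace m L → ℤˣ := lift Word.sign Word.sign_shift

lemma len_mk (W : Word m L) : (mk W).len = minimalPeriod Word.shift W := rfl

lemma sign_mk (W : Word m L) : (mk W).sign = W.sign := rfl

lemma len_pos (q : Necklace m L) : 0 < q.len := by
  obtain ⟨W, rfl⟩ := mk_surjective q
  exact minimalPeriod_pos _ _

lemma card_mk_eq (q : Necklace m L) :
    (Finset.univ.filter fun W : Word m L => mk W = q).card = q.len := by
  classical
  obtain ⟨W, rfl⟩ := mk_surjective q
  rw [len_mk, ← card_sameCycle]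
  congr 1
  ext W'
  simp [mk_eq_iff, Equiv.Perm.sameCycle_comm]

lemma sum_mk {M : Type*} [AddCommMonoid M] (g : Necklace m L → M) :
    ∑ W : Word m L, g (mk W) = ∑ q : Necklace m L, q.len • g q := by
  rw [← Finset.sum_fiberwise (s := Finset.univ) (g := (mk : Word m L → _))]
  refine Finset.sum_congr rfl fun q _ => ?_
  rw [← card_mk_eq q, Finset.sum_congr rfl (g := fun _ => g q), Finset.sum_const]
  intro W hW
  rw [(Finset.mem_filter.1 hW).2]

end Necklace

/-- The number of `i`-cycles among `c` points over each word of a necklace of length `p` and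
sign `s`. -/
def cycleExponent (s : ℤˣ) (p c i : ℕ) : ℕ :=
  if s = 1 then (if p = i then c else 0)
  else (if p = i then c % 2 else 0) + (if 2 * p = i then c / 2 else 0)

/-- Both sides count the points on `i`-cycles over a whole necklace, which consists of `p` words. -/
lemma mul_cycleExponent (s : ℤˣ) (p c i : ℕ) :
    i * cycleExponent s p c i = p * fiberCount s p c i := by
  unfold cycleExponent fiberCount
  rcases Nat.eq_zero_or_pos i with rfl | hi
  · split_ifs <;> simp_all
  · split_ifs <;> subst_vars <;> first | (exfalso; omega) | ring

section Multiplicity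

variable {m n : ℕ} (π : Equiv.Perm (Fin n)) (w : Fin n → Fin (2 * m + 1))

lemma card_itinerary_shift (W : Word m n.factorial) :
    (Finset.univ.filter fun x => itinerary π w x = Word.shift W).card =
      (Finset.univ.filter fun x => itinerary π w x = W).card := by
  symm
  refine Finset.card_equiv π fun x => ?_
  simp [itinerary_apply]

/-- The number of points whose itinerary is a given word of a necklace. -/
def multiplicity : Necklace m n.factorial → ℕ :=
  Necklace.lift (fun W => (Finset.univ.filter fun x => itinerary π w x = W).card)
    (card_itinerary_shift π w)

lemma multiplicity_mk (W : Word m n.factorial) :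
    multiplicity π w (Necklace.mk W) =
      (Finset.univ.filter fun x => itinerary π w x = W).card := rfl

lemma sum_len_mul_multiplicity : ∑ q, q.len * multiplicity π w q = n := by
  have h := Necklace.sum_mk (multiplicity π w)
  simp only [multiplicity_mk, smul_eq_mul] at h
  rw [← h, ← Finset.card_eq_sum_card_fiberwise (by simp), Finset.card_univ, Fintype.card_fin]

lemma multiplicity_le (q : Necklace m n.factorial) : multiplicity π w q ≤ n := by
  obtain ⟨W, rfl⟩ := Necklace.mk_surjective q
  rw [multiplicity_mk]
  exact (Finset.card_le_univ _).trans_eq (Fintype.card_fin n)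

variable {π w}

lemma cycleCount_eq_sum (hg : Good m π w) (i : ℕ+) :
    cycleCount i π = ∑ q, cycleExponent q.sign q.len (multiplicity π w q) i := by
  apply Nat.eq_of_mul_eq_mul_left i.pos
  rw [mul_cycleCount, Finset.mul_sum]
  simp only [mul_cycleExponent]
  have h := Necklace.sum_mk fun q => fiberCount q.sign q.len (multiplicity π w q) i
  simp only [smul_eq_mul] at h
  rw [← h, Finset.card_eq_sum_card_fiberwise (f := itinerary π w) (t := Finset.univ) (by simp)]
  refine Finset.sum_congr rfl fun W _ => ?_
  rw [Finset.filter_filter, multiplicity_mk, Necklace.len_mk, Necklace.sign_mk,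
    ← card_fiber_minimalPeriod hg]
  simp only [and_comm]

end Multiplicity

open Classical in
/-- Left enriched partitions correspond to multisets of primitive necklaces. -/
theorem sum_good {M : Type*} [AddCommMonoid M] (m n : ℕ) (F : (ℕ+ → ℕ) → M) :
    ∑ x ∈ (Finset.univ : Finset (Equiv.Perm (Fin n) × (Fin n → Fin (2 * m + 1)))).filter
        fun x => Good m x.1 x.2, F (fun i => cycleCount i x.1) =
      ∑ c ∈ (Finset.univ : Finset (Necklace m n.factorial → Fin (n + 1))).filter
        fun c => ∑ q, q.len * (c q : ℕ) = n,
        F fun i => ∑ q, cycleExponent q.sign q.len (c q) i := by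
  -- A pair is sent to its multiplicity function, whose values are at most `n`. Injectivity is
  -- `Good.eq_of_card_fiber`, surjectivity is `exists_good`, and the weights match by
  -- `cycleCount_eq_sum`.
  refine Finset.sum_bij
    (fun x _ q => ⟨multiplicity x.1 x.2 q, Nat.lt_succ_of_le (multiplicity_le _ _ q)⟩)
    ?_ ?_ ?_ ?_
  · intro x _
    simp [sum_len_mul_multiplicity]
  · rintro ⟨π, w⟩ hx ⟨π', w'⟩ hx' h
    simp only [Finset.mem_filter, Finset.mem_univ, true_and] at hx hx'
    obtain ⟨rfl, rfl⟩ := hx.eq_of_card_fiber hx' fun W => by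
      have := congrArg Fin.val (congrFun h (Necklace.mk W))
      exact this
    rfl
  · intro c hc
    simp only [Finset.mem_filter, Finset.mem_univ, true_and] at hc
    obtain ⟨π, w, hg, h⟩ := exists_good (fun W : Word m n.factorial => (c (Necklace.mk W) : ℕ))
      (fun W => by simp only [Necklace.mk_shift])
      (by
        rw [Necklace.sum_mk fun q => (c q : ℕ)]
        simpa using hc)
    refine ⟨(π, w), by simpa using hg, ?_⟩
    funext q
    obtain ⟨W, rfl⟩ := Necklace.mk_surjective q
    exact Fin.ext (h W)
  · rintro ⟨π, w⟩ hx
    simp only [Finset.mem_filter, Finset.mem_univ, true_and] at hx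
    congr 1
    funext i
    exact cycleCount_eq_sum hx i

/-! ### Counting necklaces by length and sign -/

section Counting

variable {m L : ℕ} [NeZero L]

/-- The word with a given period. -/
def Word.ofPeriod {i : ℕ} (hi : 0 < i) (hL : i ∣ L) (v : Fin i → Fin (2 * m + 1)) : Word m L :=
  ⟨fun k => v ⟨k % i, Nat.mod_lt _ hi⟩, fun k => by
    obtain ⟨j, rfl⟩ := hL
    simp⟩

/-- Words of period dividing `i` are free choices of `i` letters, so the sum is an expanded power.
-/
lemma sum_fixed_prod {i : ℕ} (hi : 0 < i) (hL : i ∣ L) (g : Fin (2 * m + 1) → ℤ) :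
    ∑ W ∈ (Finset.univ : Finset (Word m L)).filter fun W => minimalPeriod Word.shift W ∣ i,
      ∏ j ∈ Finset.range i, g (W.1 j) = (∑ a, g a) ^ i := by
  rw [← Fintype.card_fin i, ← Finset.card_univ, ← Finset.prod_const, Finset.prod_univ_sum,
    Fintype.piFinset_univ]
  simp only [Finset.card_univ, Fintype.card_fin]
  refine Finset.sum_bij' (fun W _ j => W.1 j) (fun v _ => Word.ofPeriod hi hL v) ?_ ?_ ?_ ?_ ?_
  · simp
  · intro v _
    simp only [Finset.mem_filter, Finset.mem_univ, true_and,
      ← pow_apply_eq_iff_minimalPeriod_dvd]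
    ext k
    rw [Word.shift_pow_apply]
    simp [Word.ofPeriod]
  · intro W hW
    simp only [Finset.mem_filter, Finset.mem_univ, true_and,
      ← pow_apply_eq_iff_minimalPeriod_dvd] at hW
    ext k
    have hper : Function.Periodic W.1 i := fun k => by
      rw [← Word.shift_pow_apply, hW]
    change ((W.1 (k % i) : Fin _) : ℕ) = _
    rw [hper.map_mod_nat]
  · intro v _
    funext j
    simp [Word.ofPeriod, Nat.mod_eq_of_lt j.2]
  · intro W _
    rw [Finset.prod_range]

lemma sum_letterSign : ∑ a : Fin (2 * m + 1), ((letterSign a : ℤˣ) : ℤ) = 1 := by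
  have h : ∀ a : Fin (2 * m + 1), ((letterSign a : ℤˣ) : ℤ) = (-1) ^ (a : ℕ) := by
    intro a
    unfold letterSign
    split_ifs with h
    · simp [h.neg_one_pow]
    · simp [(Nat.not_even_iff_odd.1 h).neg_one_pow]
  simp only [h]
  rw [Fin.sum_univ_eq_sum_range fun k => (-1 : ℤ) ^ k]
  induction m with
  | zero => simp
  | succ m ih =>
    rw [show 2 * (m + 1) + 1 = 2 * m + 1 + 1 + 1 by ring, Finset.sum_range_succ,
      Finset.sum_range_succ, ih fun a => by
        unfold letterSign
        split_ifs with h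
        · simp [h.neg_one_pow]
        · simp [(Nat.not_even_iff_odd.1 h).neg_one_pow]]
    ring

variable (m L)

/-- The number of necklaces of a given sign and length. -/
def necklaceCount (s : ℤˣ) (i : ℕ) : ℕ :=
  (Finset.univ.filter fun q : Necklace m L => q.len = i ∧ q.sign = s).card

variable {m L}

lemma sum_fixed_eq {i : ℕ} (hi : 0 < i) (g : ℕ → ℤˣ → ℤ) :
    ∑ W ∈ (Finset.univ : Finset (Word m L)).filter fun W => minimalPeriod Word.shift W ∣ i,
      g (minimalPeriod Word.shift W) W.sign =
    ∑ d ∈ i.divisors, (d : ℤ) *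
      (necklaceCount m L 1 d * g d 1 + necklaceCount m L (-1) d * g d (-1)) := by
  rw [Finset.sum_filter]
  have h := Necklace.sum_mk fun q : Necklace m L => if q.len ∣ i then g q.len q.sign else 0
  simp only [Necklace.len_mk, Necklace.sign_mk] at h
  refine Eq.trans h ?_
  simp only [nsmul_eq_mul, mul_ite, mul_zero]
  rw [← Finset.sum_filter, ← Finset.sum_fiberwise_of_maps_to (g := Necklace.len) (t := i.divisors)]
  · refine Finset.sum_congr rfl fun d hd => ?_
    rw [mul_add, Finset.filter_filter]
    have h1 := Finset.sum_filter_add_sum_filter_not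
      (Finset.univ.filter fun q : Necklace m L => q.len ∣ i ∧ q.len = d) (fun q => q.sign = 1)
      (fun q => (q.len : ℤ) * g q.len q.sign)
    rw [← h1]
    have hd' := Nat.dvd_of_mem_divisors hd
    congr 1
    · rw [Finset.sum_congr rfl (g := fun _ => (d : ℤ) * g d 1), Finset.sum_const, necklaceCount,
        Finset.filter_filter, nsmul_eq_mul]
      · rw [mul_left_comm]
        congr 3
        refine congrArg Finset.card ?_
        ext q
        simp only [Finset.mem_filter, Finset.mem_univ, true_and]
        constructor
        · rintro ⟨⟨-, a⟩, b⟩; exact ⟨a, b⟩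
        · rintro ⟨a, b⟩; exact ⟨⟨a ▸ hd', a⟩, b⟩
      · intro q hq
        simp only [Finset.mem_filter, Finset.mem_univ, true_and] at hq
        rw [hq.1.2, hq.2]
    · rw [Finset.sum_congr rfl (g := fun _ => (d : ℤ) * g d (-1)), Finset.sum_const,
        necklaceCount, Finset.filter_filter, nsmul_eq_mul]
      · rw [mul_left_comm]
        congr 3
        refine congrArg Finset.card ?_
        ext q
        simp only [Finset.mem_filter, Finset.mem_univ, true_and]
        constructor
        · rintro ⟨⟨-, a⟩, b⟩; exact ⟨a, units_ne_one b⟩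
        · rintro ⟨a, b⟩; exact ⟨⟨a ▸ hd', a⟩, by rw [b]; decide⟩
      · intro q hq
        simp only [Finset.mem_filter, Finset.mem_univ, true_and] at hq
        rw [hq.1.2, units_ne_one hq.2]
  · intro q hq
    rw [Nat.mem_divisors]
    exact ⟨(Finset.mem_filter.1 hq).2, hi.ne'⟩

lemma sum_necklaceCount {i : ℕ} (hi : 0 < i) (hL : i ∣ L) :
    ∑ d ∈ i.divisors, (d : ℤ) * (necklaceCount m L 1 d + necklaceCount m L (-1) d) =
      (2 * m + 1) ^ i := by
  have h1 := sum_fixed_prod (m := m) hi hL fun _ => 1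
  have h2 := sum_fixed_eq (m := m) (L := L) hi fun _ _ => 1
  simp only [mul_one] at h2
  rw [← h2]
  simpa using h1

/-- Each word fixed by the `i`-th shift is weighted by the product of its first `i` letter signs,
which is its sign to the power `i / d`. The letter signs sum to `1`, so the total is `1`. -/
lemma sum_necklaceCount_signed {i : ℕ} (hi : 0 < i) (hL : i ∣ L) :
    ∑ d ∈ i.divisors, (d : ℤ) *
      (necklaceCount m L 1 d + necklaceCount m L (-1) d * (-1) ^ (i / d)) = 1 := by
  have h1 := sum_fixed_prod (m := m) hi hL fun a => ((letterSign a : ℤˣ) : ℤ)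
  have h2 := sum_fixed_eq (m := m) (L := L) hi fun d s => ((s ^ (i / d) : ℤˣ) : ℤ)
  rw [sum_letterSign, one_pow] at h1
  refine Eq.trans ?_ h1
  simp only [one_pow, Units.val_one, mul_one, Units.val_pow_eq_pow_val, Units.val_neg] at h2
  rw [← h2]
  refine Finset.sum_congr rfl fun W hW => ?_
  simp only [Finset.mem_filter, Finset.mem_univ, true_and] at hW
  have := congrArg Units.val (Word.prefixSign_of_dvd W hW)
  rw [prefixSign, Units.coe_prod, Units.val_pow_eq_pow_val] at this
  exact this.symm

/-- Subtracting the signed count from the plain one cancels the positive necklaces and leaves `1 -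
(-1)^(i/d)`, which is nonzero only for odd `i / d`. -/
lemma sum_odd_necklaceCount {i : ℕ} (hi : 0 < i) (hL : i ∣ L) :
    ∑ d ∈ i.divisors.filter (fun d => Odd (i / d)), 2 * (d : ℤ) * necklaceCount m L (-1) d =
      (2 * m + 1) ^ i - 1 := by
  rw [← sum_necklaceCount (m := m) hi hL, ← sum_necklaceCount_signed (m := m) hi hL,
    ← Finset.sum_sub_distrib, Finset.sum_filter]
  refine Finset.sum_congr rfl fun d _ => ?_
  split_ifs with h
  · rw [h.neg_one_pow]; ring
  · rw [(Nat.not_odd_iff_even.1 h).neg_one_pow]; ring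

/-- Negative necklaces are counted by `f`. -/
theorem necklaceCount_neg (i : ℕ+) (hL : (i : ℕ) ∣ L) :
    (necklaceCount m L (-1) i : ℚ) = f i m := by
  obtain ⟨a, b, hb, hab⟩ := Nat.exists_eq_two_pow_mul_odd i.ne_zero
  have hs : ∀ x y : ℕ, x ∣ y → y ∈ {b : ℕ | Odd b ∧ 2 ^ a * b ∣ L} →
      x ∈ {b : ℕ | Odd b ∧ 2 ^ a * b ∣ L} := by
    rintro x y hxy ⟨h1, h2⟩
    exact ⟨Odd.of_dvd_nat h1 hxy, (mul_dvd_mul_left _ hxy).trans h2⟩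
  -- The divisors `d` of `2^a * b` with odd quotient are the `2^a * e` with `e ∣ b`, so the relation
  -- is inverted over the odd part only; hence the odd `d` in `f`.
  have key := (ArithmeticFunction.sum_eq_iff_sum_mul_moebius_eq_on (R := ℚ)
    (f := fun e => 2 * ((2 ^ a * e : ℕ) : ℚ) * necklaceCount m L (-1) (2 ^ a * e))
    (g := fun e => (2 * m + 1) ^ (2 ^ a * e) - 1) {b : ℕ | Odd b ∧ 2 ^ a * b ∣ L} hs).1 ?_ b
    hb.pos ⟨hb, hab ▸ hL⟩
  · simp only [← hab] at key
    have hi : (i : ℚ) ≠ 0 := by exact_mod_cast i.ne_zero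
    have h2 : ∑ d ∈ (i : ℕ).divisors.filter Odd,
        (ArithmeticFunction.moebius d : ℚ) * ((2 * (m : ℚ) + 1) ^ ((i : ℕ) / d) - 1) =
        2 * i * necklaceCount m L (-1) i := by
      rw [← key, Nat.sum_divisorsAntidiagonal fun x y =>
        (ArithmeticFunction.moebius x : ℚ) * ((2 * m + 1) ^ (2 ^ a * y) - 1)]
      have h3 : (i : ℕ).divisors.filter Odd = b.divisors := by
        ext d
        simp only [Finset.mem_filter, Nat.mem_divisors]
        constructor
        · rintro ⟨⟨h4, -⟩, h5⟩
          rw [hab] at h4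
          exact ⟨(Nat.Coprime.pow_right a h5.coprime_two_right).dvd_of_dvd_mul_left h4, hb.pos.ne'⟩
        · rintro ⟨h4, -⟩
          exact ⟨⟨hab ▸ h4.mul_left _, i.ne_zero⟩, Odd.of_dvd_nat hb h4⟩
      rw [h3]
      refine Finset.sum_congr rfl fun d hd => ?_
      rw [hab, Nat.mul_div_assoc _ (Nat.dvd_of_mem_divisors hd)]
    rw [f, h2]
    field_simp
  · rintro e he ⟨h1, h2⟩
    have h3 := sum_odd_necklaceCount (m := m) (Nat.mul_pos (Nat.two_pow_pos a) he) h2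
    have h4 := congrArg (fun x : ℤ => (x : ℚ)) h3
    push_cast at h4
    rw [← h4]
    have h5 : (2 ^ a * e).divisors.filter (fun d => Odd (2 ^ a * e / d)) =
        e.divisors.image fun x => 2 ^ a * x := by
      ext d
      simp only [Finset.mem_filter, Nat.mem_divisors, Finset.mem_image]
      constructor
      · rintro ⟨⟨⟨k, hk⟩, h5⟩, h6⟩
        have hd : 0 < d := Nat.pos_of_ne_zero (by rintro rfl; simp [hk] at h5)
        rw [hk, Nat.mul_div_cancel_left _ hd] at h6
        obtain ⟨x, rfl⟩ : 2 ^ a ∣ d :=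
          (Nat.Coprime.pow_left a h6.coprime_two_left).dvd_of_dvd_mul_right (Dvd.intro _ hk)
        rw [mul_assoc] at hk
        exact ⟨x, ⟨Dvd.intro _ (Nat.eq_of_mul_eq_mul_left (Nat.two_pow_pos a) hk).symm, he.ne'⟩,
          rfl⟩
      · rintro ⟨x, ⟨⟨k, rfl⟩, -⟩, rfl⟩
        refine ⟨⟨⟨k, by ring⟩, (Nat.mul_pos (Nat.two_pow_pos a) he).ne'⟩, ?_⟩
        rw [← mul_assoc, Nat.mul_div_cancel_left _
          (Nat.mul_pos (Nat.two_pow_pos a) (Nat.pos_of_mul_pos_right he))]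
        exact (Nat.odd_mul.1 h1).2
    rw [h5, Finset.sum_image fun x _ y _ h =>
      Nat.eq_of_mul_eq_mul_left (Nat.two_pow_pos a) h]

/-- The number of necklaces of length `i` that are positive or squares of negative ones. -/
theorem necklaceCount_pos {i : ℕ} (hi : 0 < i) (hL : i ∣ L) :
    necklaceCount m L 1 i + (if Even i then necklaceCount m L (-1) (i / 2) else 0) =
      necklaceCount m L (-1) i + if i = 1 then 1 else 0 := by
  set E := necklaceCount m L 1 with hE
  set O := necklaceCount m L (-1) with hO
  have hs : ∀ x y : ℕ, x ∣ y → y ∈ {b : ℕ | b ∣ L} → x ∈ {b : ℕ | b ∣ L} :=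
    fun x y hxy hy => hxy.trans hy
  -- The function `d * (E d + O (d / 2) - O d)` and the indicator of `1` have the same divisor sums,
  -- constantly `1`, hence they coincide.
  have key := (ArithmeticFunction.sum_eq_iff_sum_mul_moebius_eq_on (R := ℤ)
    (f := fun d => d * ((E d : ℤ) + (if Even d then (O (d / 2) : ℤ) else 0) - O d))
    (g := fun _ => 1) {b : ℕ | b ∣ L} hs).1 ?_ i hi hL
  · have key2 := (ArithmeticFunction.sum_eq_iff_sum_mul_moebius_eq_on (R := ℤ)
      (f := fun d => if d = 1 then 1 else 0)
      (g := fun _ => 1) {b : ℕ | b ∣ L} hs).1 (fun k hk _ => by simp [hk.ne']) i hi hL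
    have h := key.symm.trans key2
    zify
    rcases eq_or_ne i 1 with rfl | h1
    · simp at h ⊢
      linarith
    · have h2 : ((i : ℕ) : ℤ) ≠ 1 := by exact_mod_cast h1
      rw [if_neg h1] at h
      rw [if_neg h2]
      have := (mul_eq_zero.1 h).resolve_left (by exact_mod_cast hi.ne')
      linarith
  · intro k hk hkL
    rw [← sum_necklaceCount_signed (m := m) hk hkL]
    -- Substituting `2 * d` for `d` turns the half-length terms into a contribution from even `k /
    -- d`, which corrects `-O d` to `+O d` there.
    have h1 : ∑ d ∈ k.divisors, (d : ℤ) * (if Even d then (O (d / 2) : ℤ) else 0) =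
        ∑ d ∈ k.divisors, if Even (k / d) then 2 * (d : ℤ) * O d else 0 := by
      simp only [mul_ite, mul_zero]
      rw [← Finset.sum_filter, ← Finset.sum_filter]
      have h2 : k.divisors.filter Even =
          (k.divisors.filter fun d => Even (k / d)).image fun d => 2 * d := by
        ext d
        simp only [Finset.mem_filter, Nat.mem_divisors, Finset.mem_image]
        constructor
        · rintro ⟨⟨⟨j, rfl⟩, h2⟩, h3⟩
          obtain ⟨x, rfl⟩ := h3.two_dvd
          have hx : 0 < x := by
            rcases Nat.eq_zero_or_pos x with rfl | hx
            · simp at h2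
            · exact hx
          refine ⟨x, ⟨⟨⟨2 * j, by ring⟩, h2⟩, ?_⟩, rfl⟩
          rw [show 2 * x * j = x * (2 * j) by ring, Nat.mul_div_cancel_left _ hx]
          exact even_two_mul j
        · rintro ⟨x, ⟨⟨⟨j, rfl⟩, h2⟩, h3⟩, rfl⟩
          rw [Nat.mul_div_cancel_left _ (Nat.pos_of_mul_pos_right hk)] at h3
          obtain ⟨y, rfl⟩ := h3.two_dvd
          exact ⟨⟨⟨y, by ring⟩, h2⟩, even_two_mul x⟩
      rw [h2, Finset.sum_image fun x _ y _ h => Nat.eq_of_mul_eq_mul_left two_pos h]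
      refine Finset.sum_congr rfl fun d _ => ?_
      rw [Nat.mul_div_cancel_left _ two_pos]
      push_cast
      ring
    simp only [mul_sub, mul_add, Finset.sum_sub_distrib, Finset.sum_add_distrib]
    rw [h1, add_sub_assoc, ← Finset.sum_sub_distrib]
    congr 1
    refine Finset.sum_congr rfl fun d _ => ?_
    split_ifs with h
    · rw [h.neg_one_pow]; ring
    · rw [(Nat.not_even_iff_odd.1 h).neg_one_pow]; ring

end Counting

/-! ### The product over necklaces modulo a power of `u` -/

open MvPowerSeries

/-- The variable `z_p` indexed by a natural number. -/
def zNat (p : ℕ) : Series := z p.toPNat'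

lemma zNat_coe (i : ℕ+) : zNat (i : ℕ) = z i := by rw [zNat, PNat.coe_toPNat']

/-- The monomial `z_p u^p`. -/
def zu (p : ℕ) : Series := zNat p * u ^ p

/-- The contribution to the cycle type of `c` points over each word of a necklace of length `p` and
sign `s`. -/
def cycleWeight (s : ℤˣ) (p c : ℕ) : Series :=
  if s = 1 then zNat p ^ c else zNat p ^ (c % 2) * zNat (2 * p) ^ (c / 2)

/-- Truncation modulo `u ^ (n + 1)`. -/
def trunc (n : ℕ) : Series →+* Series ⧸ Ideal.span {u ^ (n + 1)} := Ideal.Quotient.mk _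

lemma trunc_eq_iff {n : ℕ} {a b : Series} :
    trunc n a = trunc n b ↔ ∀ e : Var →₀ ℕ, e Var.u ≤ n → coeff e a = coeff e b := by
  rw [trunc, Ideal.Quotient.mk_eq_mk_iff_sub_mem, Ideal.mem_span_singleton, u, X_pow_dvd_iff]
  simp only [Nat.lt_succ_iff, map_sub, sub_eq_zero]

lemma trunc_u_pow {n k : ℕ} (h : n < k) : trunc n (u ^ k) = 0 := by
  rw [trunc, Ideal.Quotient.eq_zero_iff_mem, Ideal.mem_span_singleton]
  exact pow_dvd_pow _ h

lemma trunc_zu {n p : ℕ} (h : n < p) : trunc n (zu p) = 0 := by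
  rw [zu, map_mul, trunc_u_pow h, mul_zero]

lemma constantCoeff_zu {p : ℕ} (hp : 0 < p) : constantCoeff (zu p) = 0 := by
  simp [zu, u, hp.ne']

lemma one_sub_zu_mul_inv {p : ℕ} (hp : 0 < p) : (1 - zu p) * (1 - zu p)⁻¹ = 1 :=
  MvPowerSeries.mul_inv_cancel _ (by simp [constantCoeff_zu hp])

/-- The truncated geometric series. -/
def geom (n p : ℕ) : Series ⧸ Ideal.span {u ^ (n + 1)} := trunc n (1 - zu p)⁻¹

lemma trunc_mul_geom {n p : ℕ} (hp : 0 < p) : trunc n (1 - zu p) * geom n p = 1 := by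
  rw [geom, ← map_mul, one_sub_zu_mul_inv hp, map_one]

lemma eq_geom_mul {n p : ℕ} (hp : 0 < p) {a b : Series ⧸ Ideal.span {(u : Series) ^ (n + 1)}}
    (h : a * trunc n (1 - zu p) = b) : a = b * geom n p := by
  rw [← h, mul_assoc, trunc_mul_geom hp, mul_one]

lemma geom_eq_one {n p : ℕ} (hp : 0 < p) (h : n < p) : geom n p = 1 := by
  have := trunc_mul_geom (n := n) hp
  rwa [map_sub, trunc_zu h, sub_zero, map_one, one_mul] at this

lemma ratPow_natCast {g : Series} (hg : constantCoeff g = 1) (k : ℕ) :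
    ratPow g (k : ℚ) = g ^ k := by
  have hs : PowerSeries.HasSubst (g - 1) :=
    PowerSeries.HasSubst.of_constantCoeff_zero (by simp [hg])
  rw [ratPow, PowerSeries.binomialSeries_nat, PowerSeries.subst_pow hs, PowerSeries.subst_add hs,
    PowerSeries.subst_X hs, ← PowerSeries.coe_substAlgHom hs, map_one, add_sub_cancel]

/-- The rational exponent is a necklace count, so the binomial series is an ordinary power. -/
lemma factor_eq {L : ℕ} [NeZero L] (m : ℕ) (i : ℕ+) (hL : (i : ℕ) ∣ L) :
    factor m i = ((1 + zu i) * (1 - zu i)⁻¹) ^ necklaceCount m L (-1) i := by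
  rw [factor, ← necklaceCount_neg i hL, ratPow_natCast, zu, zNat_coe]
  rw [← zNat_coe, ← zu]
  simp [constantCoeff_zu i.pos, constantCoeff_inv]

lemma trunc_factor {L : ℕ} [NeZero L] (m n : ℕ) (i : ℕ+) (hL : (i : ℕ) ∣ L) :
    trunc n (factor m i) =
      trunc n (1 + zu i) ^ necklaceCount m L (-1) i * geom n i ^ necklaceCount m L (-1) i := by
  rw [factor_eq m i hL, map_pow, map_mul, mul_pow]
  rfl

lemma trunc_factor_of_lt {m n : ℕ} {i : ℕ+} (h : n < i) : trunc n (factor m i) = 1 := by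
  rw [trunc_factor (L := (i : ℕ)) m n i dvd_rfl, map_add, trunc_zu h, geom_eq_one i.pos h]
  simp

lemma sum_cycleWeight_one (n p : ℕ) (hp : 0 < p) :
    trunc n (∑ c ∈ Finset.range (n + 1), u ^ (p * c) * cycleWeight 1 p c) = geom n p := by
  rw [← one_mul (geom n p)]
  refine eq_geom_mul hp ?_
  have h : ∀ c, u ^ (p * c) * cycleWeight 1 p c = zu p ^ c := fun c => by
    rw [cycleWeight, if_pos rfl, zu, mul_pow, ← pow_mul, mul_comm]
  simp only [h]
  rw [← map_mul, geom_sum_mul_neg, map_sub, map_one, zu, mul_pow, ← pow_mul, map_mul,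
    trunc_u_pow (by nlinarith), mul_zero, sub_zero]

lemma sum_cycleWeight_neg_one (n p : ℕ) (hp : 0 < p) :
    trunc n (∑ c ∈ Finset.range (n + 1), u ^ (p * c) * cycleWeight (-1) p c) =
      trunc n (1 + zu p) * geom n (2 * p) := by
  refine eq_geom_mul (by omega) ?_
  have hw : ∀ c, cycleWeight (-1) p c = zNat p ^ (c % 2) * zNat (2 * p) ^ (c / 2) := fun c =>
    if_neg (by decide)
  -- Raising `c` by `2` multiplies the summand by `zu (2 * p)`, so the sum telescopes in steps of
  -- two. The two boundary terms at the top carry powers of `u` beyond the truncation.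
  have h : ∀ N, (∑ c ∈ Finset.range N, u ^ (p * c) * cycleWeight (-1) p c) * (1 - zu (2 * p)) =
      1 + zu p - u ^ (p * N) * cycleWeight (-1) p N -
        u ^ (p * (N + 1)) * cycleWeight (-1) p (N + 1) := by
    intro N
    induction N with
    | zero => simp [hw, zu]; ring
    | succ N ih =>
      have h2 : u ^ (p * (N + 1 + 1)) * cycleWeight (-1) p (N + 1 + 1) =
          u ^ (p * N) * cycleWeight (-1) p N * zu (2 * p) := by
        rw [hw, hw, show (N + 1 + 1) % 2 = N % 2 by omega,
          show (N + 1 + 1) / 2 = N / 2 + 1 by omega, zu]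
        ring
      rw [Finset.sum_range_succ, add_mul, ih, h2]
      ring
  rw [← map_mul, h, map_sub, map_sub, map_mul, map_mul _ (u ^ (p * (n + 1 + 1))),
    trunc_u_pow (by nlinarith), trunc_u_pow (by nlinarith)]
  simp

/-- Group necklaces by length; lengths above `n` contribute `1`. Moving the factors `geom n (2 * p)`
to index `2 * p` makes the exponent of `geom n p` the left side of `necklaceCount_pos`, that is, the
exponent of `1 + zu p` plus a spare `1` at `p = 1`. -/
lemma trunc_prod_necklace (m n : ℕ) :
    ∏ q : Necklace m n.factorial,
        trunc n (∑ c ∈ Finset.range (n + 1), u ^ (q.len * c) * cycleWeight q.sign q.len c) =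
      geom n 1 * ∏ p ∈ Finset.Icc 1 n, trunc n (factor m p.toPNat') := by
  set E := necklaceCount m n.factorial 1 with hE
  set O := necklaceCount m n.factorial (-1) with hO
  have hdvd : ∀ p ∈ Finset.Icc 1 n, 0 < p ∧ p ∣ n.factorial := fun p hp => by
    rw [Finset.mem_Icc] at hp
    exact ⟨hp.1, Nat.dvd_factorial hp.1 hp.2⟩
  have hq : ∀ q : Necklace m n.factorial,
      trunc n (∑ c ∈ Finset.range (n + 1), u ^ (q.len * c) * cycleWeight q.sign q.len c) =
        if q.sign = 1 then geom n q.len else trunc n (1 + zu q.len) * geom n (2 * q.len) := by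
    intro q
    split_ifs with h
    · rw [h, sum_cycleWeight_one _ _ q.len_pos]
    · rw [units_ne_one h, sum_cycleWeight_neg_one _ _ q.len_pos]
  have h1 : ∏ q : Necklace m n.factorial,
      (if q.sign = 1 then geom n q.len else trunc n (1 + zu q.len) * geom n (2 * q.len)) =
      ∏ p ∈ Finset.Icc 1 n, (geom n p ^ E p * (trunc n (1 + zu p) * geom n (2 * p)) ^ O p) := by
    have h2 : ∏ q : Necklace m n.factorial,
        (if q.sign = 1 then geom n q.len else trunc n (1 + zu q.len) * geom n (2 * q.len)) =
        ∏ q ∈ (Finset.univ : Finset (Necklace m n.factorial)).filter (fun q => q.len ≤ n),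
        (if q.sign = 1 then geom n q.len else trunc n (1 + zu q.len) * geom n (2 * q.len)) := by
      symm
      refine Finset.prod_subset (Finset.subset_univ _) fun q _ hq => ?_
      simp only [Finset.mem_filter, Finset.mem_univ, true_and, not_le] at hq
      rw [geom_eq_one q.len_pos hq, geom_eq_one (by omega) (by omega), map_add, trunc_zu hq]
      simp
    rw [h2, ← Finset.prod_fiberwise_of_maps_to (g := Necklace.len) (t := Finset.Icc 1 n)]
    · refine Finset.prod_congr rfl fun p hp => ?_
      rw [Finset.mem_Icc] at hp
      rw [Finset.filter_filter, ← Finset.prod_filter_mul_prod_filter_not _ (fun q => q.sign = 1),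
        Finset.filter_filter, Finset.filter_filter]
      congr 1
      · rw [hE, necklaceCount, ← Finset.prod_const]
        refine Finset.prod_congr ?_ fun q hq => ?_
        · ext q
          simp only [Finset.mem_filter, Finset.mem_univ, true_and]
          constructor
          · rintro ⟨⟨-, a⟩, b⟩; exact ⟨a, b⟩
          · rintro ⟨a, b⟩; exact ⟨⟨a ▸ hp.2, a⟩, b⟩
        · simp only [Finset.mem_filter, Finset.mem_univ, true_and] at hq
          rw [if_pos hq.2, hq.1]
      · rw [hO, necklaceCount, ← Finset.prod_const]
        refine Finset.prod_congr ?_ fun q hq => ?_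
        · ext q
          simp only [Finset.mem_filter, Finset.mem_univ, true_and]
          constructor
          · rintro ⟨⟨-, a⟩, b⟩; exact ⟨a, units_ne_one b⟩
          · rintro ⟨a, b⟩; exact ⟨⟨a ▸ hp.2, a⟩, by rw [b]; decide⟩
        · simp only [Finset.mem_filter, Finset.mem_univ, true_and] at hq
          rw [if_neg (by rw [hq.2]; decide), hq.1]
    · intro q hq
      rw [Finset.mem_Icc]
      exact ⟨q.len_pos, (Finset.mem_filter.1 hq).2⟩
  have h3 : ∏ p ∈ Finset.Icc 1 n, geom n (2 * p) ^ O p =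
      ∏ p ∈ Finset.Icc 1 n, geom n p ^ (if Even p then O (p / 2) else 0) := by
    have h4 : ∏ p ∈ Finset.Icc 1 n, geom n (2 * p) ^ O p =
        ∏ p ∈ (Finset.Icc 1 n).image (fun p => 2 * p), geom n p ^ O (p / 2) := by
      rw [Finset.prod_image fun x _ y _ h => Nat.eq_of_mul_eq_mul_left two_pos h]
      refine Finset.prod_congr rfl fun p _ => ?_
      rw [Nat.mul_div_cancel_left _ two_pos]
    have h5 : ∏ p ∈ Finset.Icc 1 n, geom n p ^ (if Even p then O (p / 2) else 0) =
        ∏ p ∈ (Finset.Icc 1 n).filter Even, geom n p ^ O (p / 2) := by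
      rw [Finset.prod_filter]
      refine Finset.prod_congr rfl fun p _ => ?_
      split_ifs <;> simp
    rw [h4, h5]
    symm
    refine Finset.prod_subset ?_ fun p hp hp' => ?_
    · intro p hp
      simp only [Finset.mem_filter, Finset.mem_Icc, Finset.mem_image] at hp ⊢
      obtain ⟨⟨h6, h7⟩, k, rfl⟩ := hp
      exact ⟨k, by omega, by ring⟩
    · simp only [Finset.mem_filter, Finset.mem_Icc, Finset.mem_image] at hp hp'
      obtain ⟨k, h6, rfl⟩ := hp
      rw [geom_eq_one (by omega), one_pow]
      by_contra h7
      exact hp' ⟨by omega, even_two_mul k⟩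
  have h6 : ∏ p ∈ Finset.Icc 1 n, geom n p ^ (if p = 1 then 1 else 0) = geom n 1 := by
    rcases Nat.eq_zero_or_pos n with rfl | hn
    · rw [geom_eq_one one_pos one_pos]
      simp
    · rw [Finset.prod_eq_single_of_mem 1 (by simp; omega)]
      · simp
      · intro p _ hp
        simp [hp]
  simp only [hq]
  rw [h1]
  simp only [mul_pow, Finset.prod_mul_distrib]
  rw [h3, ← h6, mul_left_comm, ← Finset.prod_mul_distrib, ← Finset.prod_mul_distrib,
    ← Finset.prod_mul_distrib]
  refine Finset.prod_congr rfl fun p hp => ?_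
  obtain ⟨hp0, hpL⟩ := hdvd p hp
  have hp' : ((p.toPNat' : ℕ+) : ℕ) = p := Nat.toPNat'_coe p ▸ if_pos hp0
  rw [← pow_add, necklaceCount_pos hp0 hpL, trunc_factor (L := n.factorial) m n _ (hp'.symm ▸ hpL),
    hp', pow_add (geom n p)]
  ring

/-! ### Coefficientwise convergence -/

section Topology

instance : T2Space Series := by
  let _ : TopologicalSpace ℚ := ⊥
  have : DiscreteTopology ℚ := ⟨rfl⟩
  exact MvPowerSeries.WithPiTopology.instT2Space

lemma tendsto_of_eventually_coeff {ι : Type*} {l : Filter ι} {g : ι → Series} {a : Series}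
    (h : ∀ e, ∀ᶠ x in l, coeff e (g x) = coeff e a) : Filter.Tendsto g l (nhds a) := by
  let _ : TopologicalSpace ℚ := ⊥
  have : DiscreteTopology ℚ := ⟨rfl⟩
  refine (MvPowerSeries.WithPiTopology.tendsto_iff_coeff_tendsto g l a).2 fun e => ?_
  exact tendsto_nhds_of_eventually_eq (h e)

lemma hasSum_of_coeff_finset {ι : Type*} {g : ι → Series} {a : Series}
    (h : ∀ e, ∃ s : Finset ι, (∀ j ∉ s, coeff e (g j) = 0) ∧
      ∑ i ∈ s, coeff e (g i) = coeff e a) : HasSum g a := by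
  rw [HasSum, SummationFilter.unconditional_filter]
  refine tendsto_of_eventually_coeff fun e => ?_
  obtain ⟨s, h1, h2⟩ := h e
  filter_upwards [Filter.eventually_ge_atTop s] with s' hs
  rw [map_sum, ← h2]
  exact (Finset.sum_subset hs fun j _ hj => h1 j hj).symm

end Topology

/-- The product of the factors, defined coefficientwise by truncation. -/
def factorProd (m : ℕ) : Series := fun e =>
  coeff e (∏ p ∈ Finset.Icc 1 (e Var.u), factor m p.toPNat')

lemma trunc_prod_factor {m n : ℕ} {s : Finset ℕ+}
    (hs : ∀ i : ℕ+, (i : ℕ) ≤ n → i ∈ s) :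
    trunc n (∏ i ∈ s, factor m i) = trunc n (∏ p ∈ Finset.Icc 1 n, factor m p.toPNat') := by
  rw [map_prod, map_prod]
  have h : ∏ i ∈ s, trunc n (factor m i) =
      ∏ i ∈ s.filter fun i : ℕ+ => (i : ℕ) ≤ n, trunc n (factor m i) := by
    symm
    refine Finset.prod_subset (Finset.filter_subset _ _) fun i hi hi' => trunc_factor_of_lt ?_
    by_contra! h
    exact hi' (Finset.mem_filter.2 ⟨hi, h⟩)
  rw [h]
  refine Finset.prod_bij' (fun (i : ℕ+) _ => (i : ℕ)) (fun p _ => p.toPNat') ?_ ?_ ?_ ?_ ?_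
  · intro i hi
    rw [Finset.mem_Icc]
    exact ⟨i.pos, (Finset.mem_filter.1 hi).2⟩
  · intro p hp
    rw [Finset.mem_Icc] at hp
    have : ((p.toPNat' : ℕ+) : ℕ) = p := Nat.toPNat'_coe p ▸ if_pos hp.1
    rw [Finset.mem_filter, this]
    exact ⟨hs _ (this.trans_le hp.2), hp.2⟩
  · intro i _
    exact PNat.coe_toPNat' i
  · intro p hp
    rw [Finset.mem_Icc] at hp
    exact Nat.toPNat'_coe p ▸ if_pos hp.1
  · intro i _
    rw [PNat.coe_toPNat']

lemma trunc_factorProd (m n : ℕ) :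
    trunc n (factorProd m) = trunc n (∏ p ∈ Finset.Icc 1 n, factor m p.toPNat') := by
  rw [trunc_eq_iff]
  intro e he
  have h : ∀ k, e Var.u ≤ k → coeff e (∏ i ∈ (Finset.Icc 1 k).image Nat.toPNat', factor m i) =
      coeff e (∏ p ∈ Finset.Icc 1 (e Var.u), factor m p.toPNat') := by
    intro k hk
    refine trunc_eq_iff.1 (trunc_prod_factor fun i hi => ?_) e le_rfl
    rw [Finset.mem_image]
    exact ⟨i, Finset.mem_Icc.2 ⟨i.pos, hi.trans hk⟩, PNat.coe_toPNat' i⟩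
  change coeff e (∏ p ∈ Finset.Icc 1 (e Var.u), factor m p.toPNat') = _
  rw [← h n he, Finset.prod_image]
  intro x hx y hy hxy
  simp only [Finset.coe_Icc, Set.mem_Icc] at hx hy
  have h1 : ((x.toPNat' : ℕ+) : ℕ) = x := Nat.toPNat'_coe x ▸ if_pos hx.1
  have h2 : ((y.toPNat' : ℕ+) : ℕ) = y := Nat.toPNat'_coe y ▸ if_pos hy.1
  rw [← h1, ← h2, hxy]

lemma hasProd_factor (m : ℕ) : HasProd (factor m) (factorProd m) := by
  rw [HasProd, SummationFilter.unconditional_filter]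
  refine tendsto_of_eventually_coeff fun e => ?_
  filter_upwards [Filter.eventually_ge_atTop
    ((Finset.Icc 1 (e Var.u)).image Nat.toPNat')] with s hs
  suffices h : trunc (e Var.u) (∏ i ∈ s, factor m i) = trunc (e Var.u) (factorProd m) from
    trunc_eq_iff.1 h e le_rfl
  rw [trunc_factorProd]
  refine trunc_prod_factor fun i hi => hs ?_
  rw [Finset.mem_image]
  exact ⟨i, Finset.mem_Icc.2 ⟨i.pos, hi⟩, PNat.coe_toPNat' i⟩

/-! ### Coefficient extraction -/

/-- Monomials in the variables `z_i`. -/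
def zMonomials : Submonoid Series where
  carrier := {a | ∃ s : Var →₀ ℕ, s Var.t = 0 ∧ s Var.u = 0 ∧ a = monomial s 1}
  one_mem' := ⟨0, rfl, rfl, rfl⟩
  mul_mem' := by
    rintro _ _ ⟨s, h1, h2, rfl⟩ ⟨s', h3, h4, rfl⟩
    exact ⟨s + s', by simp [h1, h3], by simp [h2, h4], by simp [monomial_mul_monomial]⟩

lemma zNat_mem (p : ℕ) : zNat p ∈ zMonomials := by
  classical
  exact ⟨Finsupp.single (Var.z p.toPNat') 1, by simp, by simp, rfl⟩

lemma exists_eq_monomial {a : Series} (ha : a ∈ zMonomials) (k : ℕ) :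
    ∃ s : Var →₀ ℕ, s Var.t = 0 ∧ s Var.u = k ∧ u ^ k * a = monomial s 1 := by
  classical
  obtain ⟨s, h1, h2, rfl⟩ := ha
  refine ⟨Finsupp.single Var.u k + s, by simp [h1], by simp [h2], ?_⟩
  rw [u, X_pow_eq, monomial_mul_monomial, one_mul]

lemma coeff_u_pow_mul {a : Series} (ha : a ∈ zMonomials) {k : ℕ} {e : Var →₀ ℕ}
    (he : e Var.u ≠ k ∨ e Var.t ≠ 0) : coeff e (u ^ k * a) = 0 := by
  classical
  obtain ⟨s, h1, h2, h3⟩ := exists_eq_monomial ha k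
  rw [h3, coeff_monomial, if_neg]
  rintro rfl
  rcases he with he | he
  · exact he h2
  · exact he h1

/-- Power series in the variable `t`. -/
def tSeries : PowerSeries ℚ →ₐ[ℚ] Series :=
  PowerSeries.substAlgHom (PowerSeries.HasSubst.X Var.t)

lemma tSeries_X : tSeries PowerSeries.X = t := PowerSeries.substAlgHom_X _

lemma coeff_tSeries (g : PowerSeries ℚ) (e : Var →₀ ℕ) :
    coeff e (tSeries g) =
      open Classical in if e = Finsupp.single Var.t (e Var.t) then PowerSeries.coeff (e Var.t) g
        else 0 := by
  classical
  rw [tSeries, PowerSeries.coe_substAlgHom, PowerSeries.coeff_subst_single]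

lemma tSeries_inv {g : PowerSeries ℚ} (hg : PowerSeries.constantCoeff g ≠ 0) :
    tSeries g⁻¹ = (tSeries g)⁻¹ := by
  have h1 : tSeries g⁻¹ * tSeries g = 1 := by
    rw [← map_mul, PowerSeries.inv_mul_cancel _ hg, map_one]
  refine (MvPowerSeries.eq_inv_iff_mul_eq_one ?_).2 h1
  intro h
  have := congrArg constantCoeff h1
  rw [map_mul, h] at this
  simp at this

/-- One factor involves only `t` and the other is a monomial free of `t`, so the exponents separate.
-/
lemma coeff_tSeries_mul {a : Series} (ha : a ∈ zMonomials) (g : PowerSeries ℚ) (k : ℕ)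
    (e : Var →₀ ℕ) :
    coeff e (tSeries g * (u ^ k * a)) =
      PowerSeries.coeff (e Var.t) g * coeff (e.erase Var.t) (u ^ k * a) := by
  classical
  obtain ⟨s, h1, -, h3⟩ := exists_eq_monomial ha k
  rw [h3, coeff_mul_monomial, coeff_monomial, coeff_tSeries]
  have key : (s ≤ e ∧ e - s = Finsupp.single Var.t ((e - s) Var.t)) ↔ e.erase Var.t = s := by
    constructor
    · rintro ⟨h4, h5⟩
      ext v
      by_cases hv : v = Var.t
      · rw [hv, Finsupp.erase_same, h1]
      · rw [Finsupp.erase_ne hv]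
        have h6 := congrArg (fun x : Var →₀ ℕ => x v) h5
        simp only [Finsupp.coe_tsub, Pi.sub_apply, Finsupp.single_apply, if_neg (Ne.symm hv)] at h6
        have := h4 v
        omega
    · rintro rfl
      refine ⟨fun v => ?_, ?_⟩
      · by_cases hv : v = Var.t
        · rw [hv, Finsupp.erase_same]; exact Nat.zero_le _
        · rw [Finsupp.erase_ne hv]
      · ext v
        by_cases hv : v = Var.t
        · rw [hv]; simp
        · simp [Finsupp.erase_ne hv, Ne.symm hv]
  have h7 : (e - s) Var.t = e Var.t := by simp [h1]
  by_cases h : e.erase Var.t = s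
  · obtain ⟨h5, h6⟩ := key.2 h
    rw [if_pos h5, if_pos h6, if_pos h, h7]
  · rw [if_neg h, mul_zero]
    split_ifs with h5 h6
    · exact absurd (key.1 ⟨h5, h6⟩) h
    · rw [zero_mul]
    · rfl

/-- The monomial `u^n ∏ z_i^(v i)`, the product being over `i ≤ n`. -/
def typeMonomial (n : ℕ) (v : ℕ+ → ℕ) : Series :=
  u ^ n * ∏ i ∈ Finset.Icc 1 n, zNat i ^ v i.toPNat'

lemma prod_zNat_mem (n : ℕ) (v : ℕ+ → ℕ) :
    ∏ i ∈ Finset.Icc 1 n, zNat i ^ v i.toPNat' ∈ zMonomials :=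
  prod_mem fun _ _ => pow_mem (zNat_mem _) _

lemma coeff_typeMonomial_eq_zero {n : ℕ} {v : ℕ+ → ℕ} {e : Var →₀ ℕ}
    (he : e Var.u ≠ n ∨ e Var.t ≠ 0) : coeff e (typeMonomial n v) = 0 :=
  coeff_u_pow_mul (prod_zNat_mem n v) he

lemma coeff_tSeries_mul_typeMonomial (g : PowerSeries ℚ) (n : ℕ) (v : ℕ+ → ℕ) (e : Var →₀ ℕ) :
    coeff e (tSeries g * typeMonomial n v) =
      PowerSeries.coeff (e Var.t) g * coeff (e.erase Var.t) (typeMonomial n v) :=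
  coeff_tSeries_mul (prod_zNat_mem n v) g n e

lemma cycleWeight_mem (s : ℤˣ) (p c : ℕ) : cycleWeight s p c ∈ zMonomials := by
  unfold cycleWeight
  split_ifs
  · exact pow_mem (zNat_mem _) _
  · exact mul_mem (pow_mem (zNat_mem _) _) (pow_mem (zNat_mem _) _)

lemma prod_zNat_single {n p c : ℕ} (hp : 0 < p) (h : p * c ≤ n) :
    ∏ i ∈ Finset.Icc 1 n, zNat i ^ (if p = i then c else 0) = zNat p ^ c := by
  rcases Nat.eq_zero_or_pos c with rfl | hc
  · simp
  · rw [Finset.prod_eq_single_of_mem p (Finset.mem_Icc.2 ⟨hp, by nlinarith⟩)]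
    · simp
    · intro i _ hi
      rw [if_neg hi.symm, pow_zero]

/-- The bound `p * c ≤ n` keeps in range every index that occurs with nonzero exponent, including `2
* p`. -/
lemma cycleWeight_eq_prod {s : ℤˣ} {n p c : ℕ} (hp : 0 < p) (h : p * c ≤ n) :
    cycleWeight s p c = ∏ i ∈ Finset.Icc 1 n, zNat i ^ cycleExponent s p c i := by
  unfold cycleWeight cycleExponent
  split_ifs
  · rw [prod_zNat_single hp h]
  · simp only [pow_add, Finset.prod_mul_distrib]
    rw [prod_zNat_single hp ((Nat.mul_le_mul_left p (Nat.mod_le c 2)).trans h),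
      prod_zNat_single (by omega)]
    calc 2 * p * (c / 2) = p * (2 * (c / 2)) := by ring
      _ ≤ p * c := Nat.mul_le_mul_left p (by omega)
      _ ≤ n := h

lemma prod_cycleWeight {m n : ℕ} (c : Necklace m n.factorial → Fin (n + 1))
    (hc : ∑ q, q.len * (c q : ℕ) = n) :
    u ^ n * ∏ q, cycleWeight q.sign q.len (c q) =
      typeMonomial n fun i => ∑ q, cycleExponent q.sign q.len (c q) i := by
  rw [typeMonomial]
  congr 1
  rw [Finset.prod_congr rfl fun q _ => cycleWeight_eq_prod (n := n) q.len_pos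
    ((Finset.single_le_sum (f := fun q => q.len * (c q : ℕ)) (fun _ _ => Nat.zero_le _)
      (Finset.mem_univ q)).trans_eq hc), Finset.prod_comm]
  refine Finset.prod_congr rfl fun i hi => ?_
  have : ((i.toPNat' : ℕ+) : ℕ) = i := Nat.toPNat'_coe i ▸ if_pos (Finset.mem_Icc.1 hi).1
  rw [this, Finset.prod_pow_eq_pow_sum]

open Classical in
/-- The coefficients of the product side, for a fixed number of letters. -/
theorem coeff_product (m : ℕ) (e : Var →₀ ℕ) :
    coeff e ((1 - z 1 * u)⁻¹ * factorProd m) =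
      ∑ x ∈ (Finset.univ :
          Finset (Equiv.Perm (Fin (e Var.u)) × (Fin (e Var.u) → Fin (2 * m + 1)))).filter
        fun x => Good m x.1 x.2, coeff e (typeMonomial (e Var.u) fun i => cycleCount i x.1) := by
  set n := e Var.u with hn
  rw [sum_good m n fun v => coeff e (typeMonomial n v)]
  have h1 : trunc n ((1 - z 1 * u)⁻¹ * factorProd m) =
      trunc n (∑ c : Necklace m n.factorial → Fin (n + 1),
        ∏ q, u ^ (q.len * (c q : ℕ)) * cycleWeight q.sign q.len (c q)) := by
    have h2 : zu 1 = z 1 * u := by rw [zu, pow_one]; rfl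
    rw [map_mul, trunc_factorProd, map_prod, ← h2]
    refine (trunc_prod_necklace m n).symm.trans ?_
    rw [← map_prod]
    congr 1
    simp only [Finset.sum_range]
    rw [Finset.prod_univ_sum, Fintype.piFinset_univ]
  rw [trunc_eq_iff.1 h1 e le_rfl, map_sum, Finset.sum_filter]
  refine Finset.sum_congr rfl fun c _ => ?_
  rw [Finset.prod_mul_distrib, Finset.prod_pow_eq_pow_sum]
  split_ifs with hc
  · rw [← prod_cycleWeight c hc, hc]
  -- A configuration whose total length differs from `n` has the wrong exponent of `u`.
  · exact coeff_u_pow_mul (prod_mem fun _ _ => cycleWeight_mem _ _ _) (Or.inl (Ne.symm hc))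

/-! ### Comparison of the two sides -/

/-- The summand on the left, for any number `n` of points. -/
def leftSummand (n : ℕ) : Series :=
  ∑ π : Equiv.Perm (Fin n),
    tSeries ((1 + PowerSeries.X) ^ n * ((1 - PowerSeries.X) ^ (n + 1))⁻¹ *
      (4 * PowerSeries.X * ((1 + PowerSeries.X) ^ 2)⁻¹) ^ lpk π) *
      typeMonomial n fun i => cycleCount i π

lemma leftTerm_eq (n : ℕ+) : leftTerm n = leftSummand n := by
  rw [leftTerm, leftSummand, Finset.mul_sum]
  refine Finset.sum_congr rfl fun π _ => ?_
  have h1 : tSeries ((1 + PowerSeries.X) ^ (n : ℕ) * ((1 - PowerSeries.X) ^ ((n : ℕ) + 1))⁻¹ *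
      (4 * PowerSeries.X * ((1 + PowerSeries.X) ^ 2)⁻¹) ^ lpk π) =
      ((1 + t) ^ (n : ℕ) * ((1 - t) ^ ((n : ℕ) + 1))⁻¹) * (4 * t * ((1 + t) ^ 2)⁻¹) ^ lpk π := by
    simp only [map_mul, map_pow]
    rw [tSeries_inv (by simp), tSeries_inv (by simp)]
    simp only [map_add, map_sub, map_pow, map_one, tSeries_X, map_ofNat]
  have h2 : ∏ i ∈ Finset.Icc 1 n, z i ^ cycleCount i π =
      ∏ i ∈ Finset.Icc 1 (n : ℕ), zNat i ^ cycleCount i.toPNat' π := by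
    refine Finset.prod_bij' (fun (i : ℕ+) _ => (i : ℕ)) (fun p _ => p.toPNat') ?_ ?_ ?_ ?_ ?_
    · intro i hi
      rw [Finset.mem_Icc] at hi ⊢
      exact ⟨i.pos, hi.2⟩
    · intro p hp
      rw [Finset.mem_Icc] at hp ⊢
      refine ⟨one_le, ?_⟩
      rw [← PNat.coe_le_coe, Nat.toPNat'_coe, if_pos (Nat.lt_of_succ_le hp.1)]
      exact hp.2
    · intro i _
      exact PNat.coe_toPNat' i
    · intro p hp
      rw [Finset.mem_Icc] at hp
      exact Nat.toPNat'_coe p ▸ if_pos hp.1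
    · intro i _
      rw [zNat_coe, PNat.coe_toPNat']
  rw [h1, h2, typeMonomial]
  ring

lemma leftSummand_zero : leftSummand 0 = (1 - t)⁻¹ := by
  have h : ∀ π : Equiv.Perm (Fin 0), lpk π = 0 := fun π => by simp [lpk]
  simp only [leftSummand, h, typeMonomial]
  simp only [pow_zero, zero_add, pow_one, one_mul, mul_one, Finset.univ_unique,
    Finset.sum_singleton]
  rw [tSeries_inv (by simp)]
  simp [tSeries_X]

open Classical in
-- By `good_series`, extracting the power of `t` replaces the weight of `π` by its number of left
-- enriched partitions.
lemma coeff_leftSummand (n : ℕ) (e : Var →₀ ℕ) :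
    coeff e (leftSummand n) =
      ∑ x ∈ (Finset.univ : Finset (Equiv.Perm (Fin n) × (Fin n → Fin (2 * e Var.t + 1)))).filter
        fun x => Good (e Var.t) x.1 x.2,
        coeff (e.erase Var.t) (typeMonomial n fun i => cycleCount i x.1) := by
  rw [leftSummand, map_sum, Finset.sum_filter, Fintype.sum_prod_type]
  refine Finset.sum_congr rfl fun π _ => ?_
  rw [← good_series, coeff_tSeries_mul_typeMonomial, PowerSeries.coeff_mk,
    ← Finset.sum_filter]
  exact ((Finset.sum_const _).trans (nsmul_eq_mul _ _)).symm

lemma coeff_leftSummand_eq_zero {n : ℕ} {e : Var →₀ ℕ} (h : e Var.u ≠ n) :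
    coeff e (leftSummand n) = 0 := by
  classical
  rw [coeff_leftSummand]
  refine Finset.sum_eq_zero fun x _ => ?_
  refine coeff_typeMonomial_eq_zero (Or.inl ?_)
  rwa [Finsupp.erase_ne (by simp)]

lemma rightTerm_eq (m : ℕ) : rightTerm m = t ^ m * ((1 - z 1 * u)⁻¹ * factorProd m) := by
  rw [rightTerm, (hasProd_factor m).tprod_eq, mul_assoc]

lemma coeff_rightTerm_eq_zero {m : ℕ} {e : Var →₀ ℕ} (h : m ≠ e Var.t) :
    coeff e (rightTerm m) = 0 := by
  classical
  rw [rightTerm_eq, t, X_pow_eq, coeff_monomial_mul]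
  split_ifs with h1
  · rw [coeff_product, one_mul]
    refine Finset.sum_eq_zero fun x _ => ?_
    refine coeff_typeMonomial_eq_zero (Or.inr ?_)
    have := h1 Var.t
    simp at this ⊢
    omega
  · rfl

/-- After the power of `t` is split off, both coefficients are the same sum over good pairs. -/
lemma coeff_rightTerm (e : Var →₀ ℕ) :
    coeff e (rightTerm (e Var.t)) = coeff e (leftSummand (e Var.u)) := by
  classical
  have h1 : e - Finsupp.single Var.t (e Var.t) = e.erase Var.t := by
    ext v
    by_cases hv : v = Var.t
    · rw [hv]; simp
    · simp [Finsupp.erase_ne hv, Ne.symm hv]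
  have h2 : (e.erase Var.t) Var.u = e Var.u := Finsupp.erase_ne (by simp)
  rw [rightTerm_eq, t, X_pow_eq, coeff_monomial_mul, if_pos (by simp), one_mul, h1, coeff_product,
    coeff_leftSummand, h2]

/-- The common value of both sides. -/
def total : Series := fun e => coeff e (leftSummand (e Var.u))

lemma hasSum_rightTerm : HasSum rightTerm total :=
  hasSum_of_coeff_finset fun e =>
    ⟨{e Var.t}, fun _ hj => coeff_rightTerm_eq_zero (by simpa using hj),
      (Finset.sum_singleton _ _).trans (coeff_rightTerm e)⟩

/-- The series `total` includes `n = 0`, whose summand is `(1 - t)⁻¹`; the sum over positive `n`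
omits it. -/
lemma hasSum_leftTerm : HasSum leftTerm (total - (1 - t)⁻¹) := by
  refine hasSum_of_coeff_finset fun e => ?_
  rw [map_sub, ← leftSummand_zero]
  change ∃ s : Finset ℕ+, _ ∧ _ = coeff e (leftSummand (e Var.u)) - _
  rcases Nat.eq_zero_or_pos (e Var.u) with h | h
  · refine ⟨∅, fun j _ => ?_, ?_⟩
    · rw [leftTerm_eq, coeff_leftSummand_eq_zero]
      rw [h]
      exact j.ne_zero.symm
    · rw [h]; simp
  · obtain ⟨n, hn⟩ : ∃ n : ℕ+, (n : ℕ) = e Var.u := ⟨⟨e Var.u, h⟩, rfl⟩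
    refine ⟨{n}, fun j hj => ?_, ?_⟩
    · rw [leftTerm_eq, coeff_leftSummand_eq_zero]
      intro h'
      exact hj (Finset.mem_singleton.2 (PNat.eq (h'.symm.trans hn.symm)))
    · rw [Finset.sum_singleton, leftTerm_eq, coeff_leftSummand_eq_zero h.ne', sub_zero, hn]

end LeftPeaks

end

theorem corollary5p5 :
    (∀ m : ℕ, Multipliable (LeftPeaks.factor m)) ∧
    Summable LeftPeaks.leftTerm ∧
    Summable LeftPeaks.rightTerm ∧
    (1 - LeftPeaks.t)⁻¹ + ∑' n : ℕ+, LeftPeaks.leftTerm n =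
      ∑' m : ℕ, LeftPeaks.rightTerm m := by
  refine ⟨fun m => (LeftPeaks.hasProd_factor m).multipliable,
    LeftPeaks.hasSum_leftTerm.summable, LeftPeaks.hasSum_rightTerm.summable, ?_⟩
  rw [LeftPeaks.hasSum_leftTerm.tsum_eq, LeftPeaks.hasSum_rightTerm.tsum_eq, add_sub_cancel]
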